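/- Let $\Sigma$ be a finite alphabet and $R$ an arbitrary set of weights. An $R$-weighted automaton $\mathcal A=(Q,\Sigma,\Delta,\mathrm{wgt})$ has a finite set $Q$ of states, transitions $\Delta\subseteq Q\times\Sigma\times Q$ and a weight map $\mathrm{wgt}\colon\Delta\to R$. A run from $p$ to $q$ is a sequence of consecutive transitions leading from $p$ to $q$ (the empty sequence is a run from $p$ to $p$ with the empty label), and $L(\mathcal A_{p,q})$ is the set of labels of runs from $p$ to $q$. For $u\in\Sigma^+$, $\{\!|\mathcal A_{p,q}|\!\}(u)$ is the multiset of the weight sequences $\mathrm{wgt}(\delta_1)\cdots\mathrm{wgt}(\delta_{|u|})$ of all runs $\delta_1\cdots\delta_{|u|}$ from $p$ to $q$ with label $u$; for sets $I,F\subseteq Q$ of initial and final states, $\{\!|\mathcal A|\!\}(u)=\biguplus_{p\in I,q\in F}\{\!|\mathcal A_{p,q}|\!\}(u)$. The automaton is aperiodic if there is $m\ge1$ such that $u^m\in L(\mathcal A_{p,q})\iff u^{m+1}\in L(\mathcal A_{p,q})$ for all $p,q\in Q$, $u\in\Sigma^+$. It is SCC-unambiguous if, for all $p,q$ in the same strongly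 connected component (i.e. $p=q$, or there are runs from $p$ to $q$ and from $q$ to $p$), every $u\in\Sigma^+$ labels at most one run from $p$ to $q$. Weighted first-order formulas ($\mathsf{wFO}$) over $\Sigma$ and $R$ are given by $$\varphi::=\top\mid P_a(x)\mid x\le y\mid\neg\varphi\mid\varphi\wedge\varphi\mid\forall x\,\varphi,\qquad \Psi::=r\mid\varphi\,?\,\Psi:\Psi,\qquad \Phi::=\mathbf 0\mid\textstyle\prod_x\Psi\mid\varphi\,?\,\Phi:\Phi\mid\Phi+\Phi\mid\sum_x\Phi$$ with $a\in\Sigma$, $r\in R$ and $x,y$ variables. Over a nonempty word $u$ with a valuation $\sigma$ of the variables by positions of $u$, the formulas $\varphi$ have the usual truth value, $\Psi$ denotes a single weight, and $\Phi$ denotes a finite multiset of weight sequences: $\mathbf 0$ denotes the empty multiset, $\prod_x\Psi$ the singleton consisting of the sequence $r_1\cdots r_{|u|}$, where $r_i$ is the value of $\Psi$ at $(u,\sigma[x\mapsto i])$, $+$ denotes multiset union, and $\sum_x\Phi$ the multiset union of the values of $\Phi$ at $(u,\sigma[x\mapsto i])$ over all positions $i$ of $u$. A sentence $\Phi$ (a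 formula without free variables) thus defines a map $\{\!|\Phi|\!\}$ from $\Sigma^+$ to finite multisets of weight sequences. Theorem. Let $\mathcal A$ be an aperiodic, SCC-unambiguous $R$-weighted automaton over $\Sigma$. For each pair of states $p,q$ one can construct a $\mathsf{wFO}$ sentence $\Phi_{p,q}$ with $\{\!|\mathcal A_{p,q}|\!\}=\{\!|\Phi_{p,q}|\!\}$. Moreover, for all sets $I,F$ of initial and final states, one can construct a $\mathsf{wFO}$ sentence $\Phi$ with $\{\!|\mathcal A|\!\}=\{\!|\Phi|\!\}$. Here "one can construct" means: the sentences exist, for an arbitrary set $R$; and if the elements of $\Sigma$ and $R$ are (primitive recursively) coded by natural numbers, then there are algorithms, depending only on $\Sigma$, $R$ and their codings, which compute (Gödel numbers of) $\Phi_{p,q}$ and $\Phi$ from a list of the weighted transitions of $\mathcal A$, whose states are $0,\dots,n-1$, together with $p,q$ or with lists of the elements of $I$ and $F$, respectively. -/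

import Mathlib

/-!
The letters act on the sets of states by transformations, and aperiodicity makes the transformations
that they generate counter-free. Products of counter-free transformations along a word are invariant
under Ehrenfeucht–Fraïssé games with a bounded number of rounds: if the word is cut at the
occurrences of a letter `c`, then the segments do not contain `c`, the sequence of segments is a
word over a local divisor, which acts on the range of `c`, and induction applies to both. Hence it
is also invariant under such games whether a word has a run that takes given transitions at marked
positions. As there are finitely many equivalence classes of marked words, with representatives of
computably bounded length, this property is a disjunction of Hintikka formulas that a bounded search
finds.

Measure the depth of the strongly connected components by a height that never decreases along a
transition. By unambiguity within the components, a run is determined by its label and by its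
transitions at the canonical positions, where it first leads above each height `i`. So the runs from
`p` to `q` correspond to the tuples of transitions and positions that are canonical for some run:
the sentence sums over all these tuples, and its products read off the weight at `x` by marking the
position `x` in addition.
-/

namespace WFOAut

/-- Nonempty words over `α`, i.e. the set `α⁺`. -/
abbrev NEWord (α : Type*) := {u : List α // u ≠ []}

/-- A weighted automaton `(Q, Σ, Δ, wgt)` with states `Q`, alphabet `α` and weights in an
arbitrary set `R`: a finite set of transitions, and a weight for each transition. -/
structure WAut (α R Q : Type*) where
  trans : Finset (Q × α × Q)
  wgt : {t : Q × α × Q // t ∈ trans} → R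

namespace WAut

variable {α R Q : Type*}

/-- The type of transitions of `A`. -/
abbrev Tr (A : WAut α R Q) := {t : Q × α × Q // t ∈ A.trans}

/-- `A.IsRun p q ρ`: the sequence of transitions `ρ` is a run from `p` to `q`
(the empty run being a run from `p` to `p`). -/
def IsRun (A : WAut α R Q) : Q → Q → List A.Tr → Prop
  | p, q, [] => p = q
  | p, q, δ :: ρ => δ.1.1 = p ∧ IsRun A δ.1.2.2 q ρ

/-- The word read by a sequence of transitions. -/
def label (A : WAut α R Q) (ρ : List A.Tr) : List α := ρ.map fun δ => δ.1.2.1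

/-- The sequence of weights of a sequence of transitions. -/
def wgtSeq (A : WAut α R Q) (ρ : List A.Tr) : List R := ρ.map A.wgt

/-- The set of runs from `p` to `q` with label `u`. -/
def runs (A : WAut α R Q) (p q : Q) (u : List α) : Set (List A.Tr) :=
  {ρ | A.IsRun p q ρ ∧ A.label ρ = u}

theorem runs_finite (A : WAut α R Q) (p q : Q) (u : List α) : (A.runs p q u).Finite :=
  (List.finite_length_eq A.Tr u.length).subset fun ρ h => by
    have h2 := congrArg List.length h.2
    simpa [label] using h2

/-- The language of labels of runs from `p` to `q` (with the empty word if `p = q`). -/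
def lang (A : WAut α R Q) (p q : Q) : Set (List α) := {u | (A.runs p q u).Nonempty}

/-- The abstract semantics from `p` to `q`: a nonempty word `u` is sent to the multiset of weight
sequences of the runs from `p` to `q` with label `u`. -/
noncomputable def usem (A : WAut α R Q) (p q : Q) (u : NEWord α) : Multiset (List R) :=
  (A.runs_finite p q u.1).toFinset.val.map A.wgtSeq

/-- The abstract semantics of `A` with initial states `I` and final states `F`. -/
noncomputable def usemAcc (A : WAut α R Q) (I F : Finset Q) (u : NEWord α) : Multiset (List R) :=
  ∑ p ∈ I, ∑ q ∈ F, A.usem p q u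

/-- Aperiodicity: for some `m ≥ 1`, the words `u ^ m` and `u ^ (m + 1)` label runs between the same
pairs of states, for all nonempty words `u`. -/
def Aperiodic (A : WAut α R Q) : Prop :=
  ∃ m : ℕ, 1 ≤ m ∧ ∀ (p q : Q) (u : List α), u ≠ [] →
    ((List.replicate m u).flatten ∈ A.lang p q ↔
      (List.replicate (m + 1) u).flatten ∈ A.lang p q)

/-- `p` and `q` are in the same strongly connected component. -/
def SameSCC (A : WAut α R Q) (p q : Q) : Prop :=
  p = q ∨ ((∃ ρ, A.IsRun p q ρ) ∧ ∃ ρ, A.IsRun q p ρ)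

/-- `A` is unambiguous from `p` to `q`: every nonempty word labels at most one run. -/
def UnambiguousFrom (A : WAut α R Q) (p q : Q) : Prop :=
  ∀ u : List α, u ≠ [] → (A.runs p q u).Subsingleton

/-- `A` is unambiguous on each strongly connected component. -/
def SCCUnambiguous (A : WAut α R Q) : Prop :=
  ∀ p q : Q, A.SameSCC p q → A.UnambiguousFrom p q

/-- The list `l` is a listing (in any order, possibly with repetitions) of the weighted transitions
`(p, a, q, wgt (p, a, q))` of an automaton with states `0, …, n - 1`. -/
def ListedBy {n : ℕ} (A : WAut α R (Fin n)) (l : List (ℕ × α × ℕ × R)) : Prop :=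
  ∀ (x : ℕ) (a : α) (y : ℕ) (r : R), (x, a, y, r) ∈ l ↔
    ∃ (p q : Fin n) (h : (p, a, q) ∈ A.trans), (p : ℕ) = x ∧ (q : ℕ) = y ∧ A.wgt ⟨(p, a, q), h⟩ = r

end WAut

/-- Boolean first-order formulas over words; the variables are the natural numbers. -/
inductive FO (α : Type*) where
  | top : FO α
  | letter (a : α) (x : ℕ) : FO α
  | le (x y : ℕ) : FO α
  | neg (φ : FO α) : FO α
  | and (φ ψ : FO α) : FO α
  | all (x : ℕ) (φ : FO α) : FO α

/-- Step formulas: constants and if-then-else. -/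
inductive StepFO (α R : Type*) where
  | const (r : R) : StepFO α R
  | ite (φ : FO α) (Ψ₁ Ψ₂ : StepFO α R) : StepFO α R

/-- Weighted first-order formulas. -/
inductive WFO (α R : Type*) where
  | zero : WFO α R
  | prod (x : ℕ) (Ψ : StepFO α R) : WFO α R
  | ite (φ : FO α) (Φ₁ Φ₂ : WFO α R) : WFO α R
  | add (Φ₁ Φ₂ : WFO α R) : WFO α R
  | sum (x : ℕ) (Φ : WFO α R) : WFO α R

namespace FO

variable {α : Type*}

/-- `u, σ ⊨ φ`. Positions of `u` are numbered from `0`. -/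
def Sat (u : List α) : (ℕ → Fin u.length) → FO α → Prop
  | _, top => True
  | σ, letter a x => u.get (σ x) = a
  | σ, le x y => σ x ≤ σ y
  | σ, neg φ => ¬ Sat u σ φ
  | σ, and φ ψ => Sat u σ φ ∧ Sat u σ ψ
  | σ, all x φ => ∀ i : Fin u.length, Sat u (Function.update σ x i) φ

/-- Free variables. -/
def fv : FO α → Set ℕ
  | top => ∅
  | letter _ x => {x}
  | le x y => {x, y}
  | neg φ => fv φ
  | and φ ψ => fv φ ∪ fv ψ
  | all x φ => fv φ \ {x}

/-- Gödel number of a formula. -/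
def code [Encodable α] : FO α → ℕ
  | top => Nat.pair 0 0
  | letter a x => Nat.pair 1 (Nat.pair (Encodable.encode a) x)
  | le x y => Nat.pair 2 (Nat.pair x y)
  | neg φ => Nat.pair 3 (code φ)
  | and φ ψ => Nat.pair 4 (Nat.pair (code φ) (code ψ))
  | all x φ => Nat.pair 5 (Nat.pair x (code φ))

end FO

namespace StepFO

variable {α R : Type*}

open Classical in
/-- The semantics of a step formula is a single weight. -/
noncomputable def sem (u : List α) (σ : ℕ → Fin u.length) : StepFO α R → R
  | const r => r
  | ite φ Ψ₁ Ψ₂ => if FO.Sat u σ φ then sem u σ Ψ₁ else sem u σ Ψ₂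

/-- Free variables. -/
def fv : StepFO α R → Set ℕ
  | const _ => ∅
  | ite φ Ψ₁ Ψ₂ => φ.fv ∪ fv Ψ₁ ∪ fv Ψ₂

/-- Gödel number of a step formula. -/
def code [Encodable α] [Encodable R] : StepFO α R → ℕ
  | const r => Nat.pair 0 (Encodable.encode r)
  | ite φ Ψ₁ Ψ₂ => Nat.pair 1 (Nat.pair φ.code (Nat.pair (code Ψ₁) (code Ψ₂)))

end StepFO

namespace WFO

variable {α R : Type*}

open Classical in
/-- The semantics of a weighted formula is a multiset of weight sequences. -/
noncomputable def sem (u : List α) : (ℕ → Fin u.length) → WFO α R → Multiset (List R)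
  | _, zero => 0
  | σ, prod x Ψ => {List.ofFn fun i : Fin u.length => Ψ.sem u (Function.update σ x i)}
  | σ, ite φ Φ₁ Φ₂ => if FO.Sat u σ φ then sem u σ Φ₁ else sem u σ Φ₂
  | σ, add Φ₁ Φ₂ => sem u σ Φ₁ + sem u σ Φ₂
  | σ, sum x Φ => ∑ i : Fin u.length, sem u (Function.update σ x i) Φ

/-- Free variables. -/
def fv : WFO α R → Set ℕ
  | zero => ∅
  | prod x Ψ => Ψ.fv \ {x}
  | ite φ Φ₁ Φ₂ => φ.fv ∪ fv Φ₁ ∪ fv Φ₂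
  | add Φ₁ Φ₂ => fv Φ₁ ∪ fv Φ₂
  | sum x Φ => fv Φ \ {x}

/-- A sentence is a formula without free variables. -/
def IsSentence (Φ : WFO α R) : Prop := Φ.fv = ∅

/-- The abstract semantics of a sentence. As there are no free variables, the choice of the
valuation (here: every variable at the first position) does not matter. -/
noncomputable def usem (Φ : WFO α R) (u : NEWord α) : Multiset (List R) :=
  Φ.sem u.1 fun _ => ⟨0, List.length_pos_of_ne_nil u.2⟩

/-- Gödel number of a weighted formula. -/
def code [Encodable α] [Encodable R] : WFO α R → ℕ
  | zero => Nat.pair 0 0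
  | prod x Ψ => Nat.pair 1 (Nat.pair x Ψ.code)
  | ite φ Φ₁ Φ₂ => Nat.pair 2 (Nat.pair φ.code (Nat.pair (code Φ₁) (code Φ₂)))
  | add Φ₁ Φ₂ => Nat.pair 3 (Nat.pair (code Φ₁) (code Φ₂))
  | sum x Φ => Nat.pair 4 (Nat.pair x (code Φ))

end WFO

end WFOAut

namespace WFOAut

/-! ### Ehrenfeucht–Fraïssé games on labelled linear orders -/

section Games

variable {X Y Z A B : Type*}

/-- The pairs in `s` match positions with the same label and in the same order. -/
def IsPartialIso [LE X] [LE Y] (l : X → A) (l' : Y → A) (s : Set (X × Y)) : Prop :=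
  ∀ p ∈ s, l p.1 = l' p.2 ∧ ∀ q ∈ s, (p.1 ≤ q.1 ↔ p.2 ≤ q.2)

/-- The duplicator wins the `k`-round Ehrenfeucht–Fraïssé game on the sets of positions `P` and
`P'`, labelled by `l` and `l'`, after the pairs in `s` have been chosen. -/
def EF [LE X] [LE Y] (P : Set X) (l : X → A) (P' : Set Y) (l' : Y → A) : ℕ → Set (X × Y) → Prop
  | 0, s => IsPartialIso l l' s
  | k + 1, s => IsPartialIso l l' s ∧ (∀ x ∈ P, ∃ y ∈ P', EF P l P' l' k (insert (x, y) s)) ∧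
      ∀ y ∈ P', ∃ x ∈ P, EF P l P' l' k (insert (x, y) s)

theorem swap_preimage_insert (x : X) (y : Y) (s : Set (X × Y)) :
    (Prod.swap ⁻¹' insert (x, y) s : Set (Y × X)) = insert (y, x) (Prod.swap ⁻¹' s) := by
  ext ⟨a, b⟩
  simp [and_comm]

section LE

variable [LE X] [LE Y] [LE Z] {l : X → A} {l' : Y → A} {l'' : Z → A}
  {P : Set X} {P' : Set Y} {P'' : Set Z} {k m : ℕ} {s t : Set (X × Y)}

theorem IsPartialIso.anti (h : IsPartialIso l l' t) (hst : s ⊆ t) : IsPartialIso l l' s :=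
  fun p hp => ⟨(h p (hst hp)).1, fun q hq => (h p (hst hp)).2 q (hst hq)⟩

theorem IsPartialIso.symm (h : IsPartialIso l l' s) : IsPartialIso l' l (Prod.swap ⁻¹' s) :=
  fun p hp => ⟨((h p.swap hp).1).symm, fun q hq => ((h p.swap hp).2 q.swap hq).symm⟩

theorem IsPartialIso.trans {t : Set (Y × Z)} (h : IsPartialIso l l' s)
    (h' : IsPartialIso l' l'' t) :
    IsPartialIso l l'' {p | ∃ y, (p.1, y) ∈ s ∧ (y, p.2) ∈ t} := by
  rintro ⟨x, z⟩ ⟨y, hxy, hyz⟩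
  refine ⟨(h _ hxy).1.trans (h' _ hyz).1, ?_⟩
  rintro ⟨x₁, z₁⟩ ⟨y₁, hxy₁, hyz₁⟩
  exact ((h _ hxy).2 _ hxy₁).trans ((h' _ hyz).2 _ hyz₁)

theorem EF.isPartialIso (h : EF P l P' l' k s) : IsPartialIso l l' s := by
  cases k with
  | zero => exact h
  | succ k => exact h.1

theorem EF.label_eq (h : EF P l P' l' k s) {x : X} {y : Y} (hxy : (x, y) ∈ s) : l x = l' y :=
  (h.isPartialIso _ hxy).1

theorem EF.le_iff (h : EF P l P' l' k s) {x₁ x₂ : X} {y₁ y₂ : Y} (h₁ : (x₁, y₁) ∈ s)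
    (h₂ : (x₂, y₂) ∈ s) : x₁ ≤ x₂ ↔ y₁ ≤ y₂ :=
  (h.isPartialIso _ h₁).2 _ h₂

theorem EF.anti (h : EF P l P' l' k t) (hst : s ⊆ t) : EF P l P' l' k s := by
  induction k generalizing s t with
  | zero => exact IsPartialIso.anti h hst
  | succ k ih =>
    refine ⟨h.1.anti hst, fun x hx => ?_, fun y hy => ?_⟩
    · obtain ⟨y, hy, h'⟩ := h.2.1 x hx
      exact ⟨y, hy, ih h' (Set.insert_subset_insert hst)⟩
    · obtain ⟨x, hx, h'⟩ := h.2.2 y hy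
      exact ⟨x, hx, ih h' (Set.insert_subset_insert hst)⟩

theorem EF.of_succ (h : EF P l P' l' (k + 1) s) : EF P l P' l' k s := by
  induction k generalizing s with
  | zero => exact h.isPartialIso
  | succ k ih =>
    refine ⟨h.1, fun x hx => ?_, fun y hy => ?_⟩
    · obtain ⟨y, hy, h'⟩ := h.2.1 x hx
      exact ⟨y, hy, ih h'⟩
    · obtain ⟨x, hx, h'⟩ := h.2.2 y hy
      exact ⟨x, hx, ih h'⟩

theorem EF.of_le (h : EF P l P' l' m s) (hk : k ≤ m) : EF P l P' l' k s := by
  induction hk with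
  | refl => exact h
  | step _ ih => exact ih h.of_succ

theorem EF.symm (h : EF P l P' l' k s) : EF P' l' P l k (Prod.swap ⁻¹' s) := by
  induction k generalizing s with
  | zero => exact IsPartialIso.symm h
  | succ k ih =>
    refine ⟨h.1.symm, fun y hy => ?_, fun x hx => ?_⟩
    · obtain ⟨x, hx, h'⟩ := h.2.2 y hy
      exact ⟨x, hx, swap_preimage_insert x y s ▸ ih h'⟩
    · obtain ⟨y, hy, h'⟩ := h.2.1 x hx
      exact ⟨y, hy, swap_preimage_insert x y s ▸ ih h'⟩

theorem EF.trans {t : Set (Y × Z)} (h : EF P l P' l' k s) (h' : EF P' l' P'' l'' k t) :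
    EF P l P'' l'' k {p | ∃ y, (p.1, y) ∈ s ∧ (y, p.2) ∈ t} := by
  have insert_comp (x : X) (y : Y) (z : Z) (s : Set (X × Y)) (t : Set (Y × Z)) :
      insert (x, z) {p : X × Z | ∃ y, (p.1, y) ∈ s ∧ (y, p.2) ∈ t} ⊆
        {p | ∃ y', (p.1, y') ∈ insert (x, y) s ∧ (y', p.2) ∈ insert (y, z) t} := by
    rintro p (rfl | ⟨w, hw, hw'⟩)
    · exact ⟨y, Or.inl rfl, Or.inl rfl⟩
    · exact ⟨w, Or.inr hw, Or.inr hw'⟩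
  induction k generalizing s t with
  | zero => exact IsPartialIso.trans h h'
  | succ k ih =>
    refine ⟨h.1.trans h'.1, fun x hx => ?_, fun z hz => ?_⟩
    · obtain ⟨y, hy, h₁⟩ := h.2.1 x hx
      obtain ⟨z, hz, h₂⟩ := h'.2.1 y hy
      exact ⟨z, hz, (ih h₁ h₂).anti (insert_comp x y z s t)⟩
    · obtain ⟨y, hy, h₂⟩ := h'.2.2 z hz
      obtain ⟨x, hx, h₁⟩ := h.2.2 y hy
      exact ⟨x, hx, (ih h₁ h₂).anti (insert_comp x y z s t)⟩

theorem EF.map (h : EF P l P' l' k s) (f : A → B) : EF P (f ∘ l) P' (f ∘ l') k s := by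
  induction k generalizing s with
  | zero => exact fun p hp => ⟨congrArg f (h p hp).1, (h p hp).2⟩
  | succ k ih =>
    refine ⟨fun p hp => ⟨congrArg f (h.1 p hp).1, (h.1 p hp).2⟩, fun x hx => ?_, fun y hy => ?_⟩
    · obtain ⟨y, hy, h'⟩ := h.2.1 x hx
      exact ⟨y, hy, ih h'⟩
    · obtain ⟨x, hx, h'⟩ := h.2.2 y hy
      exact ⟨x, hx, ih h'⟩

theorem EF.forall_iff (h : EF P l P' l' (k + 1) s) {φ : X → Prop} {φ' : Y → Prop}
    (H : ∀ x ∈ P, ∀ y ∈ P', EF P l P' l' k (insert (x, y) s) → (φ x ↔ φ' y)) :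
    (∀ x ∈ P, φ x) ↔ ∀ y ∈ P', φ' y := by
  refine ⟨fun hφ y hy => ?_, fun hφ x hx => ?_⟩
  · obtain ⟨x, hx, h'⟩ := h.2.2 y hy
    exact (H x hx y hy h').1 (hφ x hx)
  · obtain ⟨y, hy, h'⟩ := h.2.1 x hx
    exact (H x hx y hy h').2 (hφ y hy)

theorem EF.exists_iff (h : EF P l P' l' (k + 1) s) {φ : X → Prop} {φ' : Y → Prop}
    (H : ∀ x ∈ P, ∀ y ∈ P', EF P l P' l' k (insert (x, y) s) → (φ x ↔ φ' y)) :
    (∃ x ∈ P, φ x) ↔ ∃ y ∈ P', φ' y := by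
  simpa using not_congr (h.forall_iff fun x hx y hy h' => not_congr (H x hx y hy h'))

theorem EF.restrict_of_subset {C : Set X} {C' : Set Y} {m : X → B} {m' : Y → B} {r : ℕ}
    {k : ℕ} {s t : Set (X × Y)} (hC : C ⊆ P) (hC' : C' ⊆ P') (h : EF P l P' l' (k + r) s)
    (H : ∀ s₁ ⊇ s, EF P l P' l' r s₁ → ∀ x ∈ P, ∀ y ∈ P', (x, y) ∈ s₁ →
      (x ∈ C ↔ y ∈ C') ∧ (x ∈ C → m x = m' y))
    (hts : t ⊆ s) (ht : t ⊆ C ×ˢ C') : EF C m C' m' k t := by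
  have isPartialIso : IsPartialIso m m' t := fun p hp =>
    ⟨(H s subset_rfl (h.of_le (by omega)) _ (hC (ht hp).1) _ (hC' (ht hp).2) (hts hp)).2
      (ht hp).1, ((h.isPartialIso.anti hts) p hp).2⟩
  cases k with
  | zero => exact isPartialIso
  | succ k =>
    rw [show k + 1 + r = (k + r) + 1 by omega] at h
    have next {x y} (h' : EF P l P' l' (k + r) (insert (x, y) s)) (hx : x ∈ C) (hy : y ∈ C') :
        EF C m C' m' k (insert (x, y) t) :=
      EF.restrict_of_subset hC hC' h' (fun s₁ h₁ => H s₁ ((Set.subset_insert _ _).trans h₁))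
        (Set.insert_subset_insert hts) (Set.insert_subset ⟨hx, hy⟩ ht)
    have mem_iff {x y} (h' : EF P l P' l' (k + r) (insert (x, y) s)) (hx : x ∈ P) (hy : y ∈ P') :
        x ∈ C ↔ y ∈ C' :=
      (H _ (Set.subset_insert _ _) (h'.of_le (by omega)) x hx y hy (Set.mem_insert _ _)).1
    refine ⟨isPartialIso, fun x hx => ?_, fun y hy => ?_⟩
    · obtain ⟨y, hy, h'⟩ := h.2.1 x (hC hx)
      have hyC := (mem_iff h' (hC hx) hy).1 hx
      exact ⟨y, hyC, next h' hx hyC⟩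
    · obtain ⟨x, hx, h'⟩ := h.2.2 y (hC' hy)
      have hxC := (mem_iff h' hx (hC' hy)).2 hy
      exact ⟨x, hxC, next h' hxC hy⟩

/-- If membership in `C ⊆ P` and a new labelling of `C` are determined by `r` rounds of the game,
then `r` extra rounds pay for playing on `C` with the new labelling instead. -/
theorem EF.restrict {C : Set X} {C' : Set Y} {m : X → B} {m' : Y → B} {r : ℕ}
    (hC : C ⊆ P) (hC' : C' ⊆ P') (h : EF P l P' l' (k + r) s)
    (H : ∀ s₁ ⊇ s, EF P l P' l' r s₁ → ∀ x ∈ P, ∀ y ∈ P', (x, y) ∈ s₁ →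
      (x ∈ C ↔ y ∈ C') ∧ (x ∈ C → m x = m' y)) : EF C m C' m' k ∅ :=
  h.restrict_of_subset hC hC' H (Set.empty_subset _) (Set.empty_subset _)

end LE

theorem EF.lt_iff [LinearOrder X] [LinearOrder Y] {l : X → A} {l' : Y → A} {P : Set X} {P' : Set Y}
    {k : ℕ} {s : Set (X × Y)} (h : EF P l P' l' k s) {x₁ x₂ : X} {y₁ y₂ : Y}
    (h₁ : (x₁, y₁) ∈ s) (h₂ : (x₂, y₂) ∈ s) : x₁ < x₂ ↔ y₁ < y₂ := by
  simpa using not_congr (h.le_iff h₂ h₁)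

theorem EF.eq_iff [PartialOrder X] [PartialOrder Y] {l : X → A} {l' : Y → A} {P : Set X}
    {P' : Set Y} {k : ℕ} {s : Set (X × Y)} (h : EF P l P' l' k s) {x₁ x₂ : X} {y₁ y₂ : Y}
    (h₁ : (x₁, y₁) ∈ s) (h₂ : (x₂, y₂) ∈ s) : x₁ = x₂ ↔ y₁ = y₂ := by
  rw [le_antisymm_iff, h.le_iff h₁ h₂, h.le_iff h₂ h₁, ← le_antisymm_iff]

end Games

/-! ### Products of labels from a counter-free set of transformations -/

section OrderedProd

variable {M : Type*} [Monoid M]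

open Classical in
/-- The product of the labels of the positions in `P` below `n`. Later positions stand further to
the left, so that transformations are applied in the order of the positions. -/
noncomputable def orderedProd (P : Set ℕ) (l : ℕ → M) : ℕ → M
  | 0 => 1
  | n + 1 => if n ∈ P then l n * orderedProd P l n else orderedProd P l n

variable {P F : Set ℕ} {l : ℕ → M} {a b n : ℕ}

theorem orderedProd_succ_of_mem (h : n ∈ P) :
    orderedProd P l (n + 1) = l n * orderedProd P l n := by
  simp [orderedProd, h]

theorem orderedProd_succ_of_notMem (h : n ∉ P) :
    orderedProd P l (n + 1) = orderedProd P l n := by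
  simp [orderedProd, h]

theorem orderedProd_mem {S : Submonoid M} (h : ∀ x ∈ P, l x ∈ S) (n : ℕ) :
    orderedProd P l n ∈ S := by
  induction n with
  | zero => exact S.one_mem
  | succ n ih =>
    by_cases hn : n ∈ P
    · exact orderedProd_succ_of_mem (l := l) hn ▸ S.mul_mem (h n hn) ih
    · exact orderedProd_succ_of_notMem (l := l) hn ▸ ih

theorem orderedProd_eq_of_forall_notMem (hab : a ≤ b) (h : ∀ x, a ≤ x → x < b → x ∉ P) :
    orderedProd P l b = orderedProd P l a := by
  induction b, hab using Nat.le_induction with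
  | base => rfl
  | succ b hab ih =>
    rw [orderedProd_succ_of_notMem (h b hab (by omega)), ih fun x h₁ h₂ => h x h₁ (by omega)]

theorem orderedProd_mul_of_mem_iff (hab : a ≤ b) (hbn : b ≤ n)
    (hF : ∀ z < n, z ∈ F ↔ z ∈ P ∧ a ≤ z ∧ z < b) :
    orderedProd F l n * orderedProd P l a = orderedProd P l b := by
  have hFb : orderedProd F l n = orderedProd F l b :=
    orderedProd_eq_of_forall_notMem hbn fun z h₁ h₂ h₃ => by have := (hF z h₂).1 h₃; omega
  have mul_eq : ∀ c, a ≤ c → c ≤ b →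
      orderedProd F l c * orderedProd P l a = orderedProd P l c := by
    intro c hac
    induction c, hac using Nat.le_induction with
    | base =>
      intro _
      rw [orderedProd_eq_of_forall_notMem (Nat.zero_le a) fun z _ h₂ h₃ => by
        have := (hF z (by omega)).1 h₃; omega]
      exact one_mul _
    | succ c hac ih =>
      intro hcb
      have hc : c ∈ F ↔ c ∈ P :=
        (hF c (by omega)).trans (and_iff_left ⟨hac, hcb⟩)
      by_cases h : c ∈ P
      · rw [orderedProd_succ_of_mem h, orderedProd_succ_of_mem (hc.2 h), mul_assoc, ih (by omega)]
      · rw [orderedProd_succ_of_notMem h, orderedProd_succ_of_notMem (mt hc.1 h), ih (by omega)]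
  rw [hFb, mul_eq b hab le_rfl]

/-- Products of labels from `B` are invariants of the `k`-round Ehrenfeucht–Fraïssé game. -/
def EFInvariant (B : Set M) (k : ℕ) : Prop :=
  ∀ ⦃P P' : Set ℕ⦄ ⦃l l' : ℕ → M⦄ ⦃N N' : ℕ⦄, (∀ x ∈ P, x < N) → (∀ x ∈ P', x < N') →
    (∀ x ∈ P, l x ∈ B) → (∀ x ∈ P', l' x ∈ B) → EF P l P' l' k ∅ →
    orderedProd P l N = orderedProd P' l' N'

theorem EFInvariant.of_closure_eq_bot {B : Set M} (hB : Submonoid.closure B = ⊥) (k : ℕ) :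
    EFInvariant B k := by
  have prod_eq_one {P : Set ℕ} {l : ℕ → M} (hl : ∀ x ∈ P, l x ∈ B) (N : ℕ) :
      orderedProd P l N = 1 :=
    Submonoid.mem_bot.1 (hB ▸ orderedProd_mem (fun x hx => Submonoid.subset_closure (hl x hx)) N)
  intro P P' l l' N N' _ _ hl hl' _
  rw [prod_eq_one hl, prod_eq_one hl']

end OrderedProd

section Segments

variable {X Y A B : Type*} [LinearOrder X] [LinearOrder Y]

/-- The positions before every occurrence of the label `c`. -/
def headSeg (P : Set X) (l : X → A) (c : A) : Set X := {z ∈ P | ∀ w ∈ P, l w = c → z < w}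

/-- The positions after every occurrence of the label `c`. -/
def tailSeg (P : Set X) (l : X → A) (c : A) : Set X := {z ∈ P | ∀ w ∈ P, l w = c → w < z}

/-- The positions after `x` and before every later occurrence of the label `c`. -/
def gapSeg (P : Set X) (l : X → A) (c : A) (x : X) : Set X :=
  {z ∈ P | x < z ∧ ∀ w ∈ P, l w = c → x < w → z < w}

/-- The occurrences of the label `c` except for the last one. -/
def nonlast (P : Set X) (l : X → A) (c : A) : Set X :=
  {x ∈ P | l x = c ∧ ∃ w ∈ P, l w = c ∧ x < w}

variable {P : Set X} {P' : Set Y} {l : X → A} {l' : Y → A} {k r : ℕ} {s : Set (X × Y)}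

theorem EF.headSeg (h : EF P l P' l' (k + 1) s) (c : A) :
    EF (headSeg P l c) l (headSeg P' l' c) l' k ∅ := by
  refine h.restrict (fun _ hx => hx.1) (fun _ hy => hy.1) fun s₁ _ h₁ x hx y hy hxy =>
    ⟨(and_iff_right hx).trans ((h₁.forall_iff fun w _ w' _ h₂ => ?_).trans (and_iff_right hy).symm),
      fun _ => h₁.label_eq hxy⟩
  rw [h₂.label_eq (Set.mem_insert _ _),
    h₂.lt_iff (Set.mem_insert_of_mem _ hxy) (Set.mem_insert _ _)]

theorem EF.tailSeg (h : EF P l P' l' (k + 1) s) (c : A) :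
    EF (tailSeg P l c) l (tailSeg P' l' c) l' k ∅ := by
  refine h.restrict (fun _ hx => hx.1) (fun _ hy => hy.1) fun s₁ _ h₁ x hx y hy hxy =>
    ⟨(and_iff_right hx).trans ((h₁.forall_iff fun w _ w' _ h₂ => ?_).trans (and_iff_right hy).symm),
      fun _ => h₁.label_eq hxy⟩
  rw [h₂.label_eq (Set.mem_insert _ _),
    h₂.lt_iff (Set.mem_insert _ _) (Set.mem_insert_of_mem _ hxy)]

theorem EF.gapSeg (h : EF P l P' l' (k + 1) s) (c : A) {x : X} {y : Y} (hxy : (x, y) ∈ s) :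
    EF (gapSeg P l c x) l (gapSeg P' l' c y) l' k ∅ := by
  refine h.restrict (fun _ hx => hx.1) (fun _ hy => hy.1) fun s₁ hs h₁ z hz z' hz' hzz' =>
    ⟨and_congr (iff_of_true hz hz') (and_congr (h₁.lt_iff (hs hxy) hzz')
      (h₁.forall_iff fun w _ w' _ h₂ => ?_)), fun _ => h₁.label_eq hzz'⟩
  rw [h₂.label_eq (Set.mem_insert _ _),
    h₂.lt_iff (Set.mem_insert_of_mem _ (hs hxy)) (Set.mem_insert _ _),
    h₂.lt_iff (Set.mem_insert_of_mem _ hzz') (Set.mem_insert _ _)]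

theorem EF.nonlast {m : X → B} {m' : Y → B} (h : EF P l P' l' (k + (r + 1)) s) (c : A)
    (hm : ∀ s₁, EF P l P' l' (r + 1) s₁ → ∀ x y, (x, y) ∈ s₁ → m x = m' y) :
    EF (nonlast P l c) m (nonlast P' l' c) m' k ∅ := by
  refine h.restrict (fun _ hx => hx.1) (fun _ hy => hy.1) fun s₁ _ h₁ x hx y hy hxy =>
    ⟨and_congr (iff_of_true hx hy) (and_congr (by rw [h₁.label_eq hxy])
      (h₁.exists_iff fun w _ w' _ h₂ => ?_)), fun _ => hm s₁ h₁ x y hxy⟩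
  rw [h₂.label_eq (Set.mem_insert _ _),
    h₂.lt_iff (Set.mem_insert_of_mem _ hxy) (Set.mem_insert _ _)]

end Segments

section Blocks

variable {M : Type*} [Monoid M] {P : Set ℕ} {l : ℕ → M} {c : M} {n x w : ℕ}

theorem orderedProd_succ_of_first (hx : x ∈ P) (hc : l x = c) (hxn : x < n)
    (hfirst : ∀ z ∈ P, l z = c → x ≤ z) :
    orderedProd P l (x + 1) = c * orderedProd (headSeg P l c) l n := by
  have h := orderedProd_mul_of_mem_iff (F := headSeg P l c) (l := l) (Nat.zero_le x) hxn.le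
    fun z _ => and_congr_right fun _ => ⟨fun h => ⟨z.zero_le, h x hx hc⟩,
      fun h w hw hwc => h.2.trans_le (hfirst w hw hwc)⟩
  rw [orderedProd_succ_of_mem hx, hc, ← h]
  exact congrArg _ (mul_one _)

theorem orderedProd_succ_of_consecutive (hx : x ∈ P) (hc : l x = c) (hxn : x < n) (hwx : w < x)
    (hnext : ∀ z ∈ P, l z = c → w < z → x ≤ z) :
    orderedProd P l (x + 1) =
      c * (orderedProd (gapSeg P l c w) l n * orderedProd P l (w + 1)) := by
  have h := orderedProd_mul_of_mem_iff (F := gapSeg P l c w) (l := l) (a := w + 1) hwx hxn.le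
    fun z _ => and_congr_right fun _ => and_congr_right fun _ => ⟨fun h => h x hx hc hwx,
      fun h v hv hvc hwv => h.trans_le (hnext v hv hvc hwv)⟩
  rw [orderedProd_succ_of_mem hx, hc, h]

theorem orderedProd_eq_of_last (hx : x ∈ P) (hc : l x = c) (hxn : x < n)
    (hlast : ∀ z ∈ P, l z = c → z ≤ x) :
    orderedProd P l n = orderedProd (tailSeg P l c) l n * orderedProd P l (x + 1) :=
  (orderedProd_mul_of_mem_iff hxn le_rfl fun _ hz => and_congr_right fun _ =>
    ⟨fun h => ⟨h x hx hc, hz⟩, fun h w hw hwc => (hlast w hw hwc).trans_lt h.1⟩).symm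

end Blocks

section CounterFree

variable {Q : Type*}

/-- No transformation generated by `B` has a nontrivial cycle. -/
def CounterFree (B : Set (Function.End Q)) : Prop :=
  ∀ g ∈ Submonoid.closure B, ∀ q, ∃ m, g^[m] q = g^[m + 1] q

theorem CounterFree.mono {B B' : Set (Function.End Q)} (hB : CounterFree B) (h : B' ⊆ B) :
    CounterFree B' :=
  fun g hg => hB g (Submonoid.closure_mono h hg)

theorem CounterFree.closure_eq_bot {B : Set (Function.End Q)} (hB : CounterFree B)
    (hinj : ∀ f ∈ B, Function.Injective f) : Submonoid.closure B = ⊥ := by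
  refine eq_bot_iff.2 (Submonoid.closure_le.2 fun f hf => Submonoid.mem_bot.2 (funext fun q => ?_))
  obtain ⟨m, hm⟩ := hB f (Submonoid.subset_closure hf) q
  exact (show q = f q from (hinj f hf).iterate m hm).symm

/-- The transformation of the range of `c` that applies `g` and then `c`. -/
def rangeMap (c g : Function.End Q) : Function.End (Set.range c) := fun y => ⟨c (g y), g y, rfl⟩

/-- The transformations of the range of `c` induced by `B`, which play the role of the local
divisor at `c` of the monoid generated by `B`. -/
def localDivisor (B : Set (Function.End Q)) (c : Function.End Q) :
    Set (Function.End (Set.range c)) :=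
  rangeMap c '' Submonoid.closure B

theorem counterFree_localDivisor {B : Set (Function.End Q)} (hB : CounterFree B)
    {c : Function.End Q} (hc : c ∈ B) : CounterFree (localDivisor B c) := by
  intro f hf y
  obtain ⟨g, hg, hfg⟩ : ∃ g ∈ Submonoid.closure B, ∀ y, (f y).1 = g y.1 := by
    induction hf using Submonoid.closure_induction with
    | mem f hf =>
      obtain ⟨g, hg, rfl⟩ := hf
      exact ⟨c * g, mul_mem (Submonoid.subset_closure hc) hg, fun _ => rfl⟩
    | one => exact ⟨1, one_mem _, fun _ => rfl⟩
    | mul f₁ f₂ _ _ ih₁ ih₂ =>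
      obtain ⟨g₁, hg₁, h₁⟩ := ih₁
      obtain ⟨g₂, hg₂, h₂⟩ := ih₂
      exact ⟨g₁ * g₂, mul_mem hg₁ hg₂, fun y => (h₁ (f₂ y)).trans (congrArg g₁ (h₂ y))⟩
  have hiter : ∀ m, (f^[m] y).1 = g^[m] y.1 := fun m =>
    (Function.Semiconj.iterate_right (f := Subtype.val) hfg m) y
  obtain ⟨m, hm⟩ := hB g hg y.1
  exact ⟨m, Subtype.ext (by rw [hiter, hiter, hm])⟩

section Decomposition

variable {P : Set ℕ} {l : ℕ → Function.End Q} {c : Function.End Q} {n : ℕ}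

/-- The transformation of the range of `c` between the occurrence `x` of `c` and the next one. -/
noncomputable def blockMap (P : Set ℕ) (l : ℕ → Function.End Q) (c : Function.End Q) (n x : ℕ) :
    Function.End (Set.range c) :=
  rangeMap c (orderedProd (gapSeg P l c x) l n)

/-- The state after the first occurrence of `c`. -/
noncomputable def afterHead (P : Set ℕ) (l : ℕ → Function.End Q) (c : Function.End Q) (n : ℕ)
    (q : Q) : Set.range c :=
  ⟨c (orderedProd (headSeg P l c) l n q), _, rfl⟩

theorem orderedProd_blockMap (hn : ∀ x ∈ P, x < n) (q : Q) {x : ℕ} (hx : x ∈ P) (hxc : l x = c) :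
    (orderedProd (nonlast P l c) (blockMap P l c n) x (afterHead P l c n q)).1 =
      orderedProd P l (x + 1) q := by
  induction x using Nat.strong_induction_on with
  | _ x ih =>
    rcases {w | (w ∈ P ∧ l w = c) ∧ w < x}.eq_empty_or_nonempty with hfirst | hne
    · have hfirst (z : ℕ) (hz : z ∈ P) (hzc : l z = c) : x ≤ z :=
        not_lt.1 fun hzx => Set.eq_empty_iff_forall_notMem.1 hfirst z ⟨⟨hz, hzc⟩, hzx⟩
      rw [orderedProd_succ_of_first hx hxc (hn x hx) hfirst,
        orderedProd_eq_of_forall_notMem (Nat.zero_le x)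
          fun z _ hzx hz => absurd (hfirst z hz.1 hz.2.1) (by omega)]
      rfl
    · obtain ⟨w, ⟨⟨hw, hwc⟩, hwx⟩, hmax⟩ :=
        BddAbove.exists_isGreatest_of_nonempty ⟨x, fun _ h => h.2.le⟩ hne
      have hnext (z : ℕ) (hz : z ∈ P) (hzc : l z = c) (hwz : w < z) : x ≤ z :=
        not_lt.1 fun hzx => absurd (hmax ⟨⟨hz, hzc⟩, hzx⟩) (by omega)
      rw [orderedProd_succ_of_consecutive hx hxc (hn x hx) hwx hnext,
        orderedProd_eq_of_forall_notMem (a := w + 1) hwx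
          fun z hwz hzx hz => absurd (hnext z hz.1 hz.2.1 (by omega)) (by omega),
        orderedProd_succ_of_mem (show w ∈ nonlast P l c from ⟨hw, hwc, x, hx, hxc, hwx⟩)]
      exact congrArg (fun y => c (orderedProd (gapSeg P l c w) l n y)) (ih w hwx hw hwc)

theorem orderedProd_eq_tail_blocks_head (hn : ∀ x ∈ P, x < n) (hc : ∃ x ∈ P, l x = c) (q : Q) :
    orderedProd P l n q = orderedProd (tailSeg P l c) l n
      (orderedProd (nonlast P l c) (blockMap P l c n) n (afterHead P l c n q)).1 := by
  obtain ⟨x, ⟨hx, hxc⟩, hmax⟩ :=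
    BddAbove.exists_isGreatest_of_nonempty (S := {x | x ∈ P ∧ l x = c})
      ⟨n, fun x hx => (hn x hx.1).le⟩ hc
  have blocks : orderedProd (nonlast P l c) (blockMap P l c n) n =
      orderedProd (nonlast P l c) (blockMap P l c n) x := by
    refine orderedProd_eq_of_forall_notMem (hn x hx).le ?_
    rintro z hxz - ⟨-, -, w, hw, hwc, hzw⟩
    exact absurd (hmax ⟨hw, hwc⟩) (by omega)
  rw [blocks, orderedProd_blockMap hn q hx hxc,
    orderedProd_eq_of_last hx hxc (hn x hx) fun z hz hzc => hmax ⟨hz, hzc⟩]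
  rfl

end Decomposition

/-- Cut the word at the occurrences of `c`: the segments avoid `c`, and the sequence of segments
becomes a word over the local divisor at `c`. -/
theorem EFInvariant.of_localDivisor {B : Set (Function.End Q)} {c : Function.End Q} {k r : ℕ}
    (hsdiff : EFInvariant (B \ {c}) r) (hdiv : EFInvariant (localDivisor B c) k) :
    EFInvariant B (k + (r + 1)) := by
  intro P P' l l' N N' hN hN' hl hl' hEF
  have head : orderedProd (headSeg P l c) l N = orderedProd (headSeg P' l' c) l' N' :=
    hsdiff (fun x h => hN x h.1) (fun x h => hN' x h.1)
      (fun x h => ⟨hl x h.1, fun hc => lt_irrefl x (h.2 x h.1 hc)⟩)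
      (fun x h => ⟨hl' x h.1, fun hc => lt_irrefl x (h.2 x h.1 hc)⟩)
      ((hEF.of_le (by omega)).headSeg c)
  have tail : orderedProd (tailSeg P l c) l N = orderedProd (tailSeg P' l' c) l' N' :=
    hsdiff (fun x h => hN x h.1) (fun x h => hN' x h.1)
      (fun x h => ⟨hl x h.1, fun hc => lt_irrefl x (h.2 x h.1 hc)⟩)
      (fun x h => ⟨hl' x h.1, fun hc => lt_irrefl x (h.2 x h.1 hc)⟩)
      ((hEF.of_le (by omega)).tailSeg c)
  have gaps (s : Set (ℕ × ℕ)) (h : EF P l P' l' (r + 1) s) (x y : ℕ) (hxy : (x, y) ∈ s) :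
      blockMap P l c N x = blockMap P' l' c N' y :=
    congrArg _ (hsdiff (fun x h => hN x h.1) (fun x h => hN' x h.1)
      (fun z h => ⟨hl z h.1, fun hc => lt_irrefl z (h.2.2 z h.1 hc h.2.1)⟩)
      (fun z h => ⟨hl' z h.1, fun hc => lt_irrefl z (h.2.2 z h.1 hc h.2.1)⟩) (h.gapSeg c hxy))
  have blocks : orderedProd (nonlast P l c) (blockMap P l c N) N =
      orderedProd (nonlast P' l' c) (blockMap P' l' c N') N' :=
    hdiv (fun x h => hN x h.1) (fun x h => hN' x h.1)
      (fun x _ => ⟨_, orderedProd_mem (fun z hz => Submonoid.subset_closure (hl z hz.1)) N, rfl⟩)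
      (fun x _ => ⟨_, orderedProd_mem (fun z hz => Submonoid.subset_closure (hl' z hz.1)) N', rfl⟩)
      (hEF.nonlast c gaps)
  have occurs : (∃ x ∈ P, l x = c) ↔ ∃ y ∈ P', l' y = c :=
    (hEF.of_le (show 0 + 1 ≤ _ by omega)).exists_iff fun x _ y _ h => by
      rw [h.label_eq (Set.mem_insert _ _)]
  by_cases hc : ∃ x ∈ P, l x = c
  · funext q
    have start : afterHead P l c N q = afterHead P' l' c N' q :=
      Subtype.ext (congrArg c (congrFun head q))
    rw [orderedProd_eq_tail_blocks_head hN hc, orderedProd_eq_tail_blocks_head hN' (occurs.1 hc),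
      tail, blocks, start]
  · have head_eq {P : Set ℕ} {l : ℕ → Function.End Q} (hc : ¬∃ x ∈ P, l x = c) :
        headSeg P l c = P :=
      Set.sep_eq_self_iff_mem_true.2 fun z _ w hw hwc => absurd ⟨w, hw, hwc⟩ hc
    rwa [head_eq hc, head_eq (mt occurs.2 hc)] at head

/-- A number of rounds that suffices for counter-free transformations of an `n`-element set:
`(n + 1) ^ (n + 1)` bounds the number of generators that can be split off. -/
def counterFreeRank : ℕ → ℕ
  | 0 => 0
  | n + 1 => (n + 1) ^ (n + 1) * (counterFreeRank n + 1)

theorem CounterFree.efInvariant_of_forall_localDivisor [Finite Q] {k : ℕ} (b : ℕ)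
    {B : Set (Function.End Q)} (hB : CounterFree B) (hb : B.ncard ≤ b)
    (hdiv : ∀ B' ⊆ B, ∀ c ∈ B', ¬Function.Injective c → EFInvariant (localDivisor B' c) k) :
    EFInvariant B (b * (k + 1)) := by
  induction b generalizing B with
  | zero =>
    have : Finite (Function.End Q) := inferInstanceAs (Finite (Q → Q))
    obtain rfl : B = ∅ := (Set.ncard_eq_zero B.toFinite).1 (Nat.le_zero.1 hb)
    exact .of_closure_eq_bot (Submonoid.closure_empty) _
  | succ b ih =>
    by_cases hinj : ∀ f ∈ B, Function.Injective f
    · exact .of_closure_eq_bot (hB.closure_eq_bot hinj) _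
    · push Not at hinj
      obtain ⟨c, hcB, hc⟩ := hinj
      have : Finite (Function.End Q) := inferInstanceAs (Finite (Q → Q))
      have hcard := Set.ncard_sdiff_singleton_lt_of_mem hcB B.toFinite
      have hsdiff := ih (hB.mono Set.sdiff_subset) (show (B \ {c}).ncard ≤ b by omega)
        fun B' hB' => hdiv B' (hB'.trans Set.sdiff_subset)
      rw [show (b + 1) * (k + 1) = k + (b * (k + 1) + 1) by ring]
      exact .of_localDivisor hsdiff (hdiv B subset_rfl c hcB hc)

/-- The group-free case of the Krohn–Rhodes and Schützenberger theorems: products of counter-free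
transformations are first-order definable. -/
theorem CounterFree.efInvariant (n : ℕ) {Q : Type*} [Finite Q] (hQ : Nat.card Q ≤ n)
    {B : Set (Function.End Q)} (hB : CounterFree B) : EFInvariant B (counterFreeRank n) := by
  induction n generalizing Q with
  | zero =>
    have : IsEmpty Q := (Nat.card_eq_zero.1 (Nat.le_zero.1 hQ)).resolve_right
      (not_infinite_iff_finite.2 inferInstance)
    exact fun _ _ _ _ _ _ _ _ _ _ _ => funext isEmptyElim
  | succ n ih =>
    refine hB.efInvariant_of_forall_localDivisor _ ?_ fun B' hB' c hcB hc =>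
      ih ?_ (counterFree_localDivisor (hB.mono hB') hcB)
    · have : Finite (Function.End Q) := inferInstanceAs (Finite (Q → Q))
      calc B.ncard ≤ Nat.card (Q → Q) := Set.ncard_le_card B
        _ = Nat.card Q ^ Nat.card Q := Nat.card_fun
        _ ≤ (n + 1) ^ (n + 1) := Nat.pow_self_mono hQ
    · have hlt : Set.range c ⊂ Set.univ :=
        Set.ssubset_univ_iff.2 fun h => hc (Finite.injective_iff_surjective.2
          (Set.range_eq_univ.1 h))
      have := Set.ncard_lt_ncard hlt
      rw [Set.ncard_univ] at this
      rw [Nat.card_coe_set_eq]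
      omega

end CounterFree

/-! ### Words up to the Ehrenfeucht–Fraïssé game -/

section Tuples

variable {X Y : Type*}

/-- The pairs of corresponding entries of two tuples. -/
def zipSet (t : List X) (t' : List Y) : Set (X × Y) := {p | p ∈ t.zip t'}

@[simp]
theorem zipSet_nil : zipSet ([] : List X) ([] : List Y) = ∅ := by simp [zipSet]

theorem zipSet_cons (t : List X) (t' : List Y) (x : X) (y : Y) :
    zipSet (x :: t) (y :: t') = insert (x, y) (zipSet t t') := by
  ext p
  simp [zipSet]

theorem zipSet_concat {t : List X} {t' : List Y} (h : t.length = t'.length) (x : X) (y : Y) :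
    zipSet (t ++ [x]) (t' ++ [y]) = insert (x, y) (zipSet t t') := by
  ext p
  simp [zipSet, List.zip_append h, or_comm]

theorem swap_preimage_zipSet (t : List X) (t' : List Y) :
    Prod.swap ⁻¹' zipSet t t' = zipSet t' t := by
  induction t generalizing t' with
  | nil => ext; simp [zipSet]
  | cons x t ih =>
    cases t' with
    | nil => ext; simp [zipSet]
    | cons y t' => rw [zipSet_cons, zipSet_cons, ← ih, swap_preimage_insert]

theorem mem_zipSet_iff_getD {t t' : List ℕ} (h : t.length = t'.length) {p : ℕ × ℕ} :
    p ∈ zipSet t t' ↔ ∃ i < t.length, p = (t.getD i 0, t'.getD i 0) := by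
  change p ∈ t.zip t' ↔ _
  simp only [List.mem_iff_getElem, List.length_zip, List.getElem_zip, ← h, min_self]
  refine exists_congr fun i => ⟨fun ⟨hi, hp⟩ => ⟨hi, ?_⟩, fun ⟨hi, hp⟩ => ⟨hi, ?_⟩⟩
  · rw [← hp, List.getD_eq_getElem _ _ hi, List.getD_eq_getElem _ _ (h ▸ hi)]
  · rw [hp, List.getD_eq_getElem _ _ hi, List.getD_eq_getElem _ _ (h ▸ hi)]

theorem EF.exists_tuple {A : Type*} [LE X] [LE Y] {P : Set X} {P' : Set Y} {l : X → A}
    {l' : Y → A} {k : ℕ} (t : List X) {s : Set (X × Y)} (h : EF P l P' l' (k + t.length) s)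
    (ht : ∀ x ∈ t, x ∈ P) :
    ∃ t' : List Y, t'.length = t.length ∧ (∀ y ∈ t', y ∈ P') ∧
      EF P l P' l' k (s ∪ zipSet t t') := by
  induction t generalizing s with
  | nil => exact ⟨[], rfl, by simp, by simpa using h⟩
  | cons x t ih =>
    obtain ⟨hx, ht⟩ := List.forall_mem_cons.1 ht
    obtain ⟨y, hy, h'⟩ := (h.of_le (k := k + t.length + 1) (by simp)).2.1 x hx
    obtain ⟨t', hlen, ht', hEF⟩ := ih h' ht
    refine ⟨y :: t', by simp [hlen], List.forall_mem_cons.2 ⟨hy, ht'⟩, ?_⟩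
    rwa [zipSet_cons, Set.union_insert, ← Set.insert_union]

end Tuples

section Words

variable {α β : Type*} {k : ℕ} {u v w : List α} {s : Set (ℕ × ℕ)}

/-- The positions of a word. -/
def positions (u : List α) : Set ℕ := {i | i < u.length}

/-- The labelling of the positions of a word by its letters. -/
def letterAt (u : List α) (i : ℕ) : Option α := u[i]?

/-- The duplicator wins the `k`-round game on two words after the pairs of positions in `s` have
been chosen. -/
abbrev WordEF (k : ℕ) (u v : List α) (s : Set (ℕ × ℕ)) : Prop :=
  EF (positions u) (letterAt u) (positions v) (letterAt v) k s

theorem WordEF.map (h : WordEF k u v s) (f : α → β) : WordEF k (u.map f) (v.map f) s := by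
  have letterAt_map (w : List α) : letterAt (w.map f) = Option.map f ∘ letterAt w :=
    funext fun i => List.getElem?_map
  have positions_map (w : List α) : positions (w.map f) = positions w := by simp [positions]
  rw [WordEF, letterAt_map, letterAt_map, positions_map, positions_map]
  exact EF.map h _

/-- The pairs of corresponding positions of the suffix `w` of `u ++ w` and `v ++ w`. -/
def suffixPairs (u v w : List α) : Set (ℕ × ℕ) :=
  {p | ∃ j < w.length, p = (u.length + j, v.length + j)}

theorem IsPartialIso.append (h : IsPartialIso (letterAt u) (letterAt v) s)
    (hs : s ⊆ positions u ×ˢ positions v) (w : List α) :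
    IsPartialIso (letterAt (u ++ w)) (letterAt (v ++ w)) (s ∪ suffixPairs u v w) := by
  have hs {p : ℕ × ℕ} (hp : p ∈ s) : p.1 < u.length ∧ p.2 < v.length := hs hp
  rintro p (hp | ⟨j, -, rfl⟩)
  · refine ⟨?_, ?_⟩
    · simpa [letterAt, List.getElem?_append, hs hp] using (h p hp).1
    · rintro q (hq | ⟨j', -, rfl⟩)
      · exact (h p hp).2 q hq
      · have := hs hp
        exact iff_of_true (by dsimp only; omega) (by dsimp only; omega)
  · refine ⟨by simp [letterAt, List.getElem?_append], ?_⟩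
    rintro q (hq | ⟨j', -, rfl⟩)
    · have := hs hq
      exact iff_of_false (by dsimp only; omega) (by dsimp only; omega)
    · simp

theorem mem_positions_append {i : ℕ} :
    i ∈ positions (u ++ w) ↔ i ∈ positions u ∨ ∃ j < w.length, i = u.length + j := by
  simp only [positions, Set.mem_ofPred_eq, List.length_append]
  refine ⟨fun h => (lt_or_ge i u.length).imp_right fun hi => ⟨i - u.length, by omega, by omega⟩, ?_⟩
  rintro (h | ⟨j, hj, rfl⟩) <;> omega

theorem WordEF.append (h : WordEF k u v s) (hs : s ⊆ positions u ×ˢ positions v) (w : List α) :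
    WordEF k (u ++ w) (v ++ w) (s ∪ suffixPairs u v w) := by
  induction k generalizing s with
  | zero => exact IsPartialIso.append h hs w
  | succ k ih =>
    have prefix_reply {x y : ℕ} (h' : WordEF k u v (insert (x, y) s)) (hx : x ∈ positions u)
        (hy : y ∈ positions v) :
        WordEF k (u ++ w) (v ++ w) (insert (x, y) (s ∪ suffixPairs u v w)) := by
      rw [← Set.insert_union]
      exact ih h' (Set.insert_subset (Set.mk_mem_prod hx hy) hs)
    have suffix_reply {j : ℕ} (hj : j < w.length) :
        WordEF k (u ++ w) (v ++ w)
          (insert (u.length + j, v.length + j) (s ∪ suffixPairs u v w)) := by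
      have hmem : (u.length + j, v.length + j) ∈ s ∪ suffixPairs u v w := Or.inr ⟨j, hj, rfl⟩
      rw [Set.insert_eq_of_mem hmem]
      exact ih h.of_succ hs
    refine ⟨h.1.append hs w, fun x hx => ?_, fun y hy => ?_⟩
    · rcases mem_positions_append.1 hx with hx | ⟨j, hj, rfl⟩
      · obtain ⟨y, hy, h'⟩ := h.2.1 x hx
        exact ⟨y, mem_positions_append.2 (.inl hy), prefix_reply h' hx hy⟩
      · exact ⟨_, mem_positions_append.2 (.inr ⟨j, hj, rfl⟩), suffix_reply hj⟩
    · rcases mem_positions_append.1 hy with hy | ⟨j, hj, rfl⟩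
      · obtain ⟨x, hx, h'⟩ := h.2.2 y hy
        exact ⟨x, mem_positions_append.2 (.inl hx), prefix_reply h' hx hy⟩
      · exact ⟨_, mem_positions_append.2 (.inr ⟨j, hj, rfl⟩), suffix_reply hj⟩

/-- Atomic types of tuples of at most `D` positions: the order of the entries and their letters. -/
abbrev AtomicType (α : Type*) (D : ℕ) : Type _ := (Fin D → Fin D → Prop) × (Fin D → Option α)

/-- Hintikka types of rank `k` of words with at most `D` chosen positions. -/
def WordType (α : Type*) (D : ℕ) : ℕ → Type _
  | 0 => AtomicType α D
  | k + 1 => AtomicType α D × Set (WordType α D k)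

/-- The atomic type of a tuple of positions; missing entries count as the position `0`. -/
def atomicType (D : ℕ) (u : List α) (t : List ℕ) : AtomicType α D :=
  (fun i j => t.getD i 0 ≤ t.getD j 0, fun i => letterAt u (t.getD i 0))

/-- The Hintikka type of rank `k` of a word with a tuple of chosen positions. -/
def wordType (D : ℕ) (u : List α) : (k : ℕ) → List ℕ → WordType α D k
  | 0, t => atomicType D u t
  | k + 1, t => (atomicType D u t, {τ | ∃ x ∈ positions u, wordType D u k (t ++ [x]) = τ})

theorem isPartialIso_of_atomicType_eq {D : ℕ} {t t' : List ℕ}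
    (h : atomicType D u t = atomicType D v t') (ht : t.length = t'.length) (hD : t.length ≤ D) :
    IsPartialIso (letterAt u) (letterAt v) (zipSet t t') := by
  intro p hp
  obtain ⟨i, hi, rfl⟩ := (mem_zipSet_iff_getD ht).1 hp
  refine ⟨congrFun (congrArg Prod.snd h) ⟨i, by omega⟩, fun q hq => ?_⟩
  obtain ⟨j, hj, rfl⟩ := (mem_zipSet_iff_getD ht).1 hq
  exact iff_of_eq (congrFun (congrFun (congrArg Prod.fst h) ⟨i, by omega⟩) ⟨j, by omega⟩)

theorem WordEF.of_wordType_eq {D : ℕ} {t t' : List ℕ} (h : wordType D u k t = wordType D v k t')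
    (ht : t.length = t'.length) (hD : t.length + k ≤ D) : WordEF k u v (zipSet t t') := by
  induction k generalizing t t' with
  | zero => exact isPartialIso_of_atomicType_eq h ht hD
  | succ k ih =>
    have next := congrArg Prod.snd h
    refine ⟨isPartialIso_of_atomicType_eq (congrArg Prod.fst h) ht (by omega),
      fun x hx => ?_, fun y hy => ?_⟩
    · obtain ⟨y, hy, h'⟩ : wordType D u k (t ++ [x]) ∈ (wordType D v (k + 1) t').2 :=
        next ▸ ⟨x, hx, rfl⟩
      exact ⟨y, hy, zipSet_concat ht x y ▸ ih h'.symm (by simp [ht]) (by simp; omega)⟩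
    · obtain ⟨x, hx, h'⟩ : wordType D v k (t' ++ [y]) ∈ (wordType D u (k + 1) t).2 :=
        next ▸ ⟨y, hy, rfl⟩
      exact ⟨x, hx, zipSet_concat ht x y ▸ ih h' (by simp [ht]) (by simp; omega)⟩

/-- The number of Hintikka types of rank `k` over an alphabet with `b` letters. -/
def wordTypeCount (b D : ℕ) : ℕ → ℕ
  | 0 => (2 ^ D) ^ D * (b + 1) ^ D
  | k + 1 => (2 ^ D) ^ D * (b + 1) ^ D * 2 ^ wordTypeCount b D k

theorem wordTypeCount_mono {b b' : ℕ} (h : b ≤ b') (D k : ℕ) :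
    wordTypeCount b D k ≤ wordTypeCount b' D k := by
  induction k with
  | zero => unfold wordTypeCount; gcongr
  | succ k ih => unfold wordTypeCount; gcongr; norm_num

instance [Finite α] (D k : ℕ) : Finite (WordType α D k) := by
  induction k with
  | zero => exact inferInstanceAs (Finite (AtomicType α D))
  | succ k ih => exact inferInstanceAs (Finite (AtomicType α D × Set (WordType α D k)))

theorem card_wordType (α : Type*) [Finite α] (D k : ℕ) :
    Nat.card (WordType α D k) = wordTypeCount (Nat.card α) D k := by
  have card_atomicType : Nat.card (AtomicType α D) = (2 ^ D) ^ D * (Nat.card α + 1) ^ D := by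
    simp [Nat.card_fun, Finite.card_option]
  induction k with
  | zero => exact card_atomicType
  | succ k ih =>
    change Nat.card (AtomicType α D × (WordType α D k → Prop)) = _
    simp only [Nat.card_prod, card_atomicType, Nat.card_fun, ih, wordTypeCount,
      Nat.card_eq_fintype_card, Fintype.card_prop]

theorem exists_shorter_wordEF [Finite α] (hu : wordTypeCount (Nat.card α) k k ≤ u.length) :
    ∃ v : List α, v.length < u.length ∧ WordEF k u v ∅ := by
  obtain ⟨i, j, hij, hty⟩ : ∃ i j : Fin (u.length + 1), i ≠ j ∧
      wordType k (u.take i) k [] = wordType k (u.take j) k [] := by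
    have := Fintype.ofFinite (WordType α k k)
    refine Fintype.exists_ne_map_eq_of_card_lt
      (fun i : Fin (u.length + 1) => wordType k (u.take i) k []) ?_
    rw [Fintype.card_fin, ← Nat.card_eq_fintype_card, card_wordType]
    omega
  wlog hlt : i < j generalizing i j
  · exact this j i hij.symm hty.symm (lt_of_le_of_ne (not_lt.1 hlt) hij.symm)
  have prefixes : WordEF k (u.take j) (u.take i) ∅ := by
    simpa using WordEF.of_wordType_eq (D := k) hty.symm rfl (by simp)
  have hEF := (prefixes.append (Set.empty_subset _) (u.drop j)).anti (Set.empty_subset _)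
  rw [List.take_append_drop] at hEF
  exact ⟨u.take i ++ u.drop j, by simp; omega, hEF⟩

theorem exists_short_wordEF [Finite α] (k : ℕ) (u : List α) :
    ∃ v : List α, v.length < wordTypeCount (Nat.card α) k k ∧ WordEF k u v ∅ := by
  induction hn : u.length using Nat.strong_induction_on generalizing u with
  | _ n ih =>
    subst hn
    by_cases hu : u.length < wordTypeCount (Nat.card α) k k
    · exact ⟨u, hu, by
        simpa using WordEF.of_wordType_eq (D := k) (t := []) (t' := []) rfl rfl (by simp)⟩
    · obtain ⟨v, hvu, huv⟩ := exists_shorter_wordEF (not_lt.1 hu)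
      obtain ⟨w, hw, hvw⟩ := ih _ hvu v rfl
      exact ⟨w, hw, (huv.trans hvw).anti (Set.empty_subset _)⟩

theorem exists_short_wordEF_of_letters {L : List α} (k : ℕ) (hu : ∀ a ∈ u, a ∈ L) :
    ∃ v : List α, (∀ a ∈ v, a ∈ L) ∧ v.length < wordTypeCount L.length k k ∧ WordEF k u v ∅ := by
  classical
  have hcard : Nat.card {a // a ∈ L} ≤ L.length := by
    rw [Nat.subtype_card L.toFinset (by simp)]
    exact L.toFinset_card_le
  obtain ⟨v, hv, hEF⟩ := exists_short_wordEF (α := {a // a ∈ L}) k (u.attachWith _ hu)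
  refine ⟨v.map Subtype.val, by simp +contextual, ?_, by simpa using hEF.map Subtype.val⟩
  rw [List.length_map]
  exact hv.trans_le (wordTypeCount_mono hcard k k)

end Words

/-! ### Hintikka formulas -/

namespace FO

variable {α : Type*} {u w : List α} {σ : ℕ → Fin u.length}

/-- Conjunction of a list of formulas. -/
def conj : List (FO α) → FO α
  | [] => top
  | φ :: L => and φ (conj L)

/-- Disjunction of a list of formulas. -/
def disj (L : List (FO α)) : FO α := neg (conj (L.map neg))

/-- Existential quantification. -/
def ex (x : ℕ) (φ : FO α) : FO α := neg (all x (neg φ))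

@[simp]
theorem sat_conj {L : List (FO α)} : Sat u σ (conj L) ↔ ∀ φ ∈ L, Sat u σ φ := by
  induction L with
  | nil => simp [conj, Sat]
  | cons φ L ih => simp [conj, Sat, ih]

@[simp]
theorem sat_disj {L : List (FO α)} : Sat u σ (disj L) ↔ ∃ φ ∈ L, Sat u σ φ := by
  simp [disj, Sat]

@[simp]
theorem sat_ex {x : ℕ} {φ : FO α} :
    Sat u σ (ex x φ) ↔ ∃ i, Sat u (Function.update σ x i) φ := by
  simp [ex, Sat]

theorem fv_conj_subset {L : List (FO α)} {V : Set ℕ} (h : ∀ φ ∈ L, φ.fv ⊆ V) :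
    (conj L).fv ⊆ V := by
  induction L with
  | nil => exact Set.empty_subset V
  | cons φ L ih =>
    obtain ⟨hφ, hL⟩ := List.forall_mem_cons.1 h
    exact Set.union_subset hφ (ih hL)

theorem fv_disj_subset {L : List (FO α)} {V : Set ℕ} (h : ∀ φ ∈ L, φ.fv ⊆ V) :
    (disj L).fv ⊆ V :=
  fv_conj_subset (List.forall_mem_map.2 h)

/-- The letter at the variable `i` is the one at the position `x` of `w`; vacuous if `x` is not a
position of `w`. -/
def letterEq (w : List α) (x i : ℕ) : FO α := (w[x]?).elim top fun a => letter a i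

/-- The variables `i` and `j` are ordered like `x` and `y`. -/
def orderEq (x y i j : ℕ) : FO α := if x ≤ y then le i j else neg (le i j)

/-- The atomic diagram of the word `w` with chosen positions `t`, which are represented by the
variables `0, …, t.length - 1`. -/
def diagram (w : List α) (t : List ℕ) : FO α :=
  and (conj ((List.range t.length).map fun i => letterEq w (t.getD i 0) i))
    (conj ((List.range t.length).map fun i =>
      conj ((List.range t.length).map fun j => orderEq (t.getD i 0) (t.getD j 0) i j)))

/-- The Hintikka formula of rank `k` of the word `w` with chosen positions `t`, which are
represented by the variables `0, …, t.length - 1`. -/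
def hintikka (w : List α) : ℕ → List ℕ → FO α
  | 0, t => diagram w t
  | k + 1, t => and (diagram w t)
      (and (conj (((List.range w.length).map fun x => hintikka w k (t ++ [x])).map (ex t.length)))
        (all t.length (disj ((List.range w.length).map fun x => hintikka w k (t ++ [x])))))

theorem fv_diagram_subset (w : List α) (t : List ℕ) : (diagram w t).fv ⊆ {i | i < t.length} := by
  refine Set.union_subset (fv_conj_subset (List.forall_mem_map.2 fun i hi => ?_))
    (fv_conj_subset (List.forall_mem_map.2 fun i hi =>
      fv_conj_subset (List.forall_mem_map.2 fun j hj => ?_)))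
  · rw [List.mem_range] at hi
    unfold letterEq
    cases w[t.getD i 0]? <;> simp [fv, hi]
  · rw [List.mem_range] at hi hj
    unfold orderEq
    split_ifs <;> simp [fv, Set.insert_subset_iff, hi, hj]

theorem fv_hintikka_subset (w : List α) (k : ℕ) (t : List ℕ) :
    (hintikka w k t).fv ⊆ {i | i < t.length} := by
  induction k generalizing t with
  | zero => exact fv_diagram_subset w t
  | succ k ih =>
    have fv_next (x : ℕ) : (hintikka w k (t ++ [x])).fv ⊆ {t.length} ∪ {i | i < t.length} := by
      refine (ih _).trans fun i hi => ?_
      simpa [Nat.lt_succ_iff_lt_or_eq, or_comm, Nat.le_iff_lt_or_eq] using hi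
    refine Set.union_subset (fv_diagram_subset w t) (Set.union_subset ?_ ?_)
    · rw [List.map_map]
      exact fv_conj_subset (List.forall_mem_map.2 fun x _ => Set.sdiff_subset_iff.2 (fv_next x))
    · exact Set.sdiff_subset_iff.2 (fv_disj_subset (List.forall_mem_map.2 fun x _ => fv_next x))

/-- The positions assigned to the first `d` variables. -/
def vals (σ : ℕ → Fin u.length) (d : ℕ) : List ℕ := (List.range d).map fun i => (σ i).1

@[simp]
theorem length_vals (d : ℕ) : (vals σ d).length = d := by simp [vals]

theorem getD_vals {d i : ℕ} (h : i < d) : (vals σ d).getD i 0 = (σ i).1 := by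
  simp [vals, h]

theorem vals_update (d : ℕ) (i : Fin u.length) :
    vals (Function.update σ d i) (d + 1) = vals σ d ++ [i.1] := by
  simp only [vals, List.range_succ, List.map_append, List.map_cons, List.map_nil,
    Function.update_self, List.append_cancel_right_eq]
  refine List.map_congr_left fun j hj => ?_
  rw [Function.update_of_ne (List.mem_range.1 hj).ne]

theorem forall_mem_zipSet_vals {t : List ℕ} {φ : ℕ × ℕ → Prop} :
    (∀ p ∈ zipSet t (vals σ t.length), φ p) ↔ ∀ i < t.length, φ (t.getD i 0, (σ i).1) := by
  have hlen : t.length = (vals σ t.length).length := by simp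
  refine ⟨fun h i hi => h _ ((mem_zipSet_iff_getD hlen).2 ⟨i, hi, by rw [getD_vals hi]⟩),
    fun h p hp => ?_⟩
  obtain ⟨i, hi, rfl⟩ := (mem_zipSet_iff_getD hlen).1 hp
  exact getD_vals (σ := σ) hi ▸ h i hi

theorem sat_letterEq {x i : ℕ} (hx : x < w.length) :
    Sat u σ (letterEq w x i) ↔ letterAt w x = letterAt u (σ i).1 := by
  rw [letterEq, letterAt, letterAt, List.getElem?_eq_getElem hx, List.getElem?_eq_getElem (σ i).2]
  simp [Sat, eq_comm]

theorem sat_orderEq {x y i j : ℕ} :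
    Sat u σ (orderEq x y i j) ↔ (x ≤ y ↔ (σ i).1 ≤ (σ j).1) := by
  unfold orderEq
  split_ifs with h
  · simp only [Sat, h, true_iff, Fin.le_def]
  · simp only [Sat, h, false_iff, Fin.le_def]

theorem sat_diagram {t : List ℕ} (ht : ∀ x ∈ t, x < w.length) :
    Sat u σ (diagram w t) ↔
      IsPartialIso (letterAt w) (letterAt u) (zipSet t (vals σ t.length)) := by
  have hlt {i : ℕ} (hi : i < t.length) : t.getD i 0 < w.length :=
    ht _ (by rw [List.getD_eq_getElem _ _ hi]; simp)
  simp only [diagram, Sat, sat_conj, List.forall_mem_map, List.mem_range, sat_orderEq,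
    IsPartialIso, forall_mem_zipSet_vals, ← forall₂_and]
  exact forall₂_congr fun i hi => and_congr_left fun _ => sat_letterEq (hlt hi)

theorem sat_hintikka {k : ℕ} {t : List ℕ} (ht : ∀ x ∈ t, x < w.length) :
    Sat u σ (hintikka w k t) ↔ WordEF k w u (zipSet t (vals σ t.length)) := by
  induction k generalizing t σ with
  | zero => exact sat_diagram ht
  | succ k ih =>
    have sat_next {x : ℕ} (hx : x < w.length) (i : Fin u.length) :
        Sat u (Function.update σ t.length i) (hintikka w k (t ++ [x])) ↔
          WordEF k w u (insert (x, i.1) (zipSet t (vals σ t.length))) := by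
      rw [ih (by simpa [or_imp, forall_and] using ⟨ht, hx⟩), List.length_append,
        List.length_singleton, vals_update, zipSet_concat (by simp)]
    simp only [hintikka, Sat, sat_diagram ht, sat_conj, sat_disj, List.mem_map, List.mem_range,
      exists_exists_and_eq_and, forall_exists_index, and_imp, forall_apply_eq_imp_iff₂, sat_ex, EF,
      positions, Set.mem_ofPred_eq]
    refine and_congr Iff.rfl (and_congr (forall₂_congr fun x hx => ?_) ?_)
    · simp only [sat_next hx, Fin.exists_iff, exists_prop]
      rfl
    · rw [Fin.forall_iff]
      exact forall₂_congr fun y hy => exists_congr fun x => and_congr_right fun hx =>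
        sat_next hx ⟨y, hy⟩

end FO

/-! ### Runs through lists of weighted transitions -/

/-- A weighted transition: source, letter, target, weight. -/
abbrev Edge (α R : Type*) := ℕ × α × ℕ × R

section Runs

variable {α R : Type*} {l : List (Edge α R)} {p q : ℕ} {u v : List α} {ρ ρ' : List (Edge α R)}
  {δ : Edge α R}

/-- `ρ` is a sequence of consecutive transitions from `p` to `q`. -/
def Path : ℕ → ℕ → List (Edge α R) → Prop
  | p, q, [] => p = q
  | p, q, δ :: ρ => δ.1 = p ∧ Path δ.2.2.1 q ρ

theorem path_append : Path p q (ρ ++ ρ') ↔ ∃ s, Path p s ρ ∧ Path s q ρ' := by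
  induction ρ generalizing p with
  | nil => simp [Path]
  | cons δ ρ ih => simp [Path, ih, and_assoc]

theorem path_concat : Path p q (ρ ++ [δ]) ↔ Path p δ.1 ρ ∧ δ.2.2.1 = q := by
  rw [path_append]
  simp only [Path]
  exact ⟨fun ⟨_, h₁, h₂, h₃⟩ => ⟨h₂ ▸ h₁, h₃⟩, fun ⟨h₁, h₂⟩ => ⟨_, h₁, rfl, h₂⟩⟩

/-- `ρ` is a run from `p` to `q` with label `u`, with transitions from `l`. -/
def Run (l : List (Edge α R)) (p q : ℕ) (u : List α) (ρ : List (Edge α R)) : Prop :=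
  (∀ δ ∈ ρ, δ ∈ l) ∧ Path p q ρ ∧ ρ.map (fun δ => δ.2.1) = u

theorem Run.length_eq (h : Run l p q u ρ) : ρ.length = u.length := by
  rw [← h.2.2, List.length_map]

theorem exists_run_append :
    (∃ ρ, Run l p q (u ++ v) ρ) ↔ ∃ s, (∃ ρ, Run l p s u ρ) ∧ ∃ ρ, Run l s q v ρ := by
  constructor
  · rintro ⟨ρ, hl, hpath, hlabel⟩
    obtain ⟨ρ₁, ρ₂, rfl, hu, hv⟩ := List.map_eq_append_iff.1 hlabel
    obtain ⟨s, hpath₁, hpath₂⟩ := path_append.1 hpath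
    rw [List.forall_mem_append] at hl
    exact ⟨s, ⟨ρ₁, hl.1, hpath₁, hu⟩, ρ₂, hl.2, hpath₂, hv⟩
  · rintro ⟨s, ⟨ρ₁, hl₁, hpath₁, rfl⟩, ρ₂, hl₂, hpath₂, rfl⟩
    exact ⟨ρ₁ ++ ρ₂, List.forall_mem_append.2 ⟨hl₁, hl₂⟩, path_append.2 ⟨s, hpath₁, hpath₂⟩,
      List.map_append⟩

theorem exists_run_nil : (∃ ρ, Run l p q [] ρ) ↔ p = q := by
  constructor
  · rintro ⟨ρ, -, hpath, hlabel⟩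
    obtain rfl := List.map_eq_nil_iff.1 hlabel
    exact hpath
  · rintro rfl
    exact ⟨[], by simp, rfl, rfl⟩

/-- Aperiodicity of a list of transitions. -/
def EdgesAperiodic (l : List (Edge α R)) : Prop :=
  ∃ m : ℕ, ∀ (p q : ℕ) (u : List α), u ≠ [] →
    ((∃ ρ, Run l p q (List.replicate m u).flatten ρ) ↔
      ∃ ρ, Run l p q (List.replicate (m + 1) u).flatten ρ)

/-- Unambiguity of a list of transitions within strongly connected components. -/
def EdgesUnambiguous (l : List (Edge α R)) : Prop :=
  ∀ p q : ℕ, (∃ u ρ, Run l p q u ρ) → (∃ u ρ, Run l q p u ρ) →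
    ∀ u ρ ρ', Run l p q u ρ → Run l p q u ρ' → ρ = ρ'

/-- The states that occur in a list of transitions. -/
def states (l : List (Edge α R)) : List ℕ := l.map (fun δ => δ.1) ++ l.map (fun δ => δ.2.2.1)

theorem length_states (l : List (Edge α R)) : (states l).length = 2 * l.length := by
  simp [states, two_mul]

/-- The type of states that occur in a list of transitions. -/
abbrev State (l : List (Edge α R)) := {x : ℕ // x ∈ states l}

instance (l : List (Edge α R)) : Finite (State l) := (List.finite_toSet (states l)).to_subtype

theorem card_state_le (l : List (Edge α R)) : Nat.card (State l) ≤ 2 * l.length := by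
  have hmem (x : ℕ) : x ∈ states l ↔ x ∈ (states l).toFinset := List.mem_toFinset.symm
  calc Nat.card (State l) = Nat.card (states l).toFinset :=
        Nat.card_congr (Equiv.subtypeEquivRight hmem)
    _ = (states l).toFinset.card := Nat.card_eq_card_toFinset _ |>.trans (by simp)
    _ ≤ 2 * l.length := (List.toFinset_card_le _).trans_eq (length_states l)

theorem card_set_state_le (l : List (Edge α R)) :
    Nat.card (Set (State l)) ≤ 2 ^ (2 * l.length) := by
  classical
  have := Fintype.ofFinite (State l)
  rw [Nat.card_eq_fintype_card, Fintype.card_set, ← Nat.card_eq_fintype_card]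
  exact Nat.pow_le_pow_right two_pos (card_state_le l)

theorem source_mem_states (h : δ ∈ l) : δ.1 ∈ states l :=
  List.mem_append_left _ (List.mem_map_of_mem h)

theorem target_mem_states (h : δ ∈ l) : δ.2.2.1 ∈ states l :=
  List.mem_append_right _ (List.mem_map_of_mem h)

theorem Run.source_mem (h : Run l p q u ρ) (hu : u ≠ []) : p ∈ states l := by
  obtain ⟨hl, hpath, rfl⟩ := h
  cases ρ with
  | nil => exact absurd rfl hu
  | cons δ ρ => exact hpath.1 ▸ source_mem_states (hl δ List.mem_cons_self)

theorem Run.target_mem (h : Run l p q u ρ) (hu : u ≠ []) : q ∈ states l := by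
  obtain ⟨hl, hpath, rfl⟩ := h
  cases ρ using List.reverseRecOn with
  | nil => exact absurd rfl hu
  | append_singleton ρ δ => exact (path_concat.1 hpath).2 ▸ target_mem_states (hl δ (by simp))

/-- The action of a set of transitions on sets of states. -/
def act (l : List (Edge α R)) (T : Set (Edge α R)) : Function.End (Set (State l)) :=
  fun X => {y | ∃ δ ∈ T, δ ∈ l ∧ (∃ x ∈ X, x.1 = δ.1) ∧ δ.2.2.1 = y.1}

/-- The action of words on sets of states. -/
def runImage (l : List (Edge α R)) (u : List α) : Function.End (Set (State l)) :=
  fun X => {y | ∃ x ∈ X, ∃ ρ, Run l x.1 y.1 u ρ}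

theorem act_empty (l : List (Edge α R)) (T : Set (Edge α R)) : act l T ∅ = ∅ := by
  ext y
  simp [act]

theorem act_eq_empty_or_eq_univ {T : Set (Edge α R)} (hT : T.Subsingleton) (X : Set (State l)) :
    act l T X = ∅ ∨ act l T X = act l T Set.univ := by
  refine or_iff_not_imp_left.2 fun hne => ?_
  obtain ⟨-, δ, hδ, -, hx, -⟩ := Set.nonempty_iff_ne_empty.2 hne
  ext y
  refine exists_congr fun δ' => and_congr_right fun hδ' => and_congr_right fun hl =>
    and_congr_left fun _ => ?_
  obtain rfl := hT hδ hδ'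
  exact iff_of_true hx ⟨⟨δ.1, source_mem_states hl⟩, Set.mem_univ _, rfl⟩

theorem runImage_nil (l : List (Edge α R)) : runImage l [] = 1 := by
  funext X
  ext y
  change (∃ x ∈ X, ∃ ρ, Run l x.1 y.1 [] ρ) ↔ y ∈ X
  simp only [exists_run_nil, ← Subtype.ext_iff, exists_eq_right]

theorem runImage_singleton (l : List (Edge α R)) (a : α) :
    runImage l [a] = act l {δ | δ.2.1 = a} := by
  funext X
  ext y
  constructor
  · rintro ⟨x, hx, ρ, hl, hpath, hlabel⟩
    obtain ⟨δ, rfl, hδ⟩ := List.map_eq_singleton_iff.1 hlabel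
    exact ⟨δ, hδ, hl δ (by simp), ⟨x, hx, hpath.1.symm⟩, hpath.2⟩
  · rintro ⟨δ, hδ, hl, ⟨x, hx, hsource⟩, htarget⟩
    exact ⟨x, hx, [δ], by simpa using hl, ⟨hsource.symm, htarget⟩, congrArg (fun a => [a]) hδ⟩

theorem runImage_append (l : List (Edge α R)) (u v : List α) :
    runImage l (u ++ v) = runImage l v * runImage l u := by
  funext X
  ext y
  constructor
  · rintro ⟨x, hx, hrun⟩
    obtain ⟨s, ⟨ρ, hρ⟩, hv⟩ := exists_run_append.1 hrun
    have hs : s ∈ states l := by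
      by_cases hu : u = []
      · subst hu
        exact exists_run_nil.1 ⟨ρ, hρ⟩ ▸ x.2
      · exact hρ.target_mem hu
    exact ⟨⟨s, hs⟩, ⟨x, hx, ρ, hρ⟩, hv⟩
  · rintro ⟨s, ⟨x, hx, hu⟩, hv⟩
    exact ⟨x, hx, exists_run_append.2 ⟨s, hu, hv⟩⟩

theorem iterate_runImage (l : List (Edge α R)) (u : List α) (m : ℕ) :
    (runImage l u)^[m] = runImage l (List.replicate m u).flatten := by
  induction m with
  | zero => exact (runImage_nil l).symm
  | succ m ih =>
    rw [List.replicate_succ', List.flatten_append, List.flatten_singleton, runImage_append, ← ih]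
    exact Function.iterate_succ' (runImage l u) m

theorem EdgesAperiodic.exists_iterate_runImage (hl : EdgesAperiodic l) (u : List α) :
    ∃ m, (runImage l u)^[m] = (runImage l u)^[m + 1] := by
  rcases eq_or_ne u [] with rfl | hu
  · exact ⟨0, by rw [runImage_nil]; rfl⟩
  · obtain ⟨m, hm⟩ := hl
    refine ⟨m, ?_⟩
    simp only [iterate_runImage]
    unfold runImage
    simp only [hm _ _ u hu]

/-- The actions of letters and of at most one transition. -/
def actions (l : List (Edge α R)) : Set (Function.End (Set (State l))) :=
  {f | (∃ a, f = act l {δ | δ.2.1 = a}) ∨ ∃ T : Set (Edge α R), T.Subsingleton ∧ f = act l T}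

theorem map_empty_of_mem_closure_actions {g : Function.End (Set (State l))}
    (hg : g ∈ Submonoid.closure (actions l)) : g ∅ = ∅ := by
  induction hg using Submonoid.closure_induction_left with
  | one => rfl
  | mul_left f hf g _ ih =>
    change f (g ∅) = ∅
    rcases hf with ⟨a, rfl⟩ | ⟨T, -, rfl⟩ <;> rw [ih, act_empty]

theorem eq_runImage_or_of_mem_closure_actions {g : Function.End (Set (State l))}
    (hg : g ∈ Submonoid.closure (actions l)) :
    (∃ u, g = runImage l u) ∨ ∃ Y, ∀ X, g X = ∅ ∨ g X = Y := by
  induction hg using Submonoid.closure_induction_left with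
  | one => exact .inl ⟨[], (runImage_nil l).symm⟩
  | mul_left f hf g _ ih =>
    rcases hf with ⟨a, rfl⟩ | ⟨T, hT, rfl⟩
    · rcases ih with ⟨u, rfl⟩ | ⟨Y, hY⟩
      · exact .inl ⟨u ++ [a], by rw [runImage_append, runImage_singleton]⟩
      · exact .inr ⟨act l {δ | δ.2.1 = a} Y, fun X => (hY X).imp
          (fun h => (congrArg (act l _) h).trans (act_empty _ _)) (congrArg (act l _))⟩
    · exact .inr ⟨_, fun X => act_eq_empty_or_eq_univ hT (g X)⟩

theorem counterFree_actions (hl : EdgesAperiodic l) : CounterFree (actions l) := by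
  intro g hg X
  have hg_empty := map_empty_of_mem_closure_actions hg
  rcases eq_runImage_or_of_mem_closure_actions hg with ⟨u, rfl⟩ | ⟨Y, hY⟩
  · obtain ⟨m, hm⟩ := hl.exists_iterate_runImage u
    exact ⟨m, congrFun hm X⟩
  · rcases hY X with hX | hX
    · exact ⟨1, show g X = g (g X) by rw [hX, hg_empty]⟩
    · rcases hY Y with h | h
      · exact ⟨2, show g (g X) = g (g (g X)) by rw [hX, h, hg_empty]⟩
      · exact ⟨1, show g X = g (g X) by rw [hX, h]⟩

theorem exists_length_succ_iff {X : Type*} {n : ℕ} {φ : List X → Prop} :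
    (∃ ρ, ρ.length = n + 1 ∧ φ ρ) ↔ ∃ ρ, ρ.length = n ∧ ∃ x, φ (ρ ++ [x]) := by
  constructor
  · rintro ⟨ρ, hlen, hρ⟩
    cases ρ using List.reverseRecOn with
    | nil => simp at hlen
    | append_singleton ρ x => exact ⟨ρ, by simpa using hlen, x, hρ⟩
  · rintro ⟨ρ, hlen, x, hρ⟩
    exact ⟨ρ ++ [x], by simp [hlen], hρ⟩

theorem forall_getElem?_concat {X : Type*} {ρ : List X} {x : X} {φ : ℕ → X → Prop} :
    (∀ i y, (ρ ++ [x])[i]? = some y → φ i y) ↔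
      (∀ i y, ρ[i]? = some y → φ i y) ∧ φ ρ.length x := by
  simp only [List.getElem?_append, List.getElem?_singleton]
  constructor
  · refine fun h => ⟨fun i y hi => h i y ?_, h _ _ (by simp)⟩
    rwa [if_pos (List.getElem?_eq_some_iff.1 hi).1]
  · rintro ⟨hρ, hx⟩ i y hi
    split_ifs at hi with h₁ h₂
    · exact hρ i y hi
    · obtain rfl : i = ρ.length := by omega
      exact Option.some.inj hi ▸ hx

theorem mem_orderedProd_act {T : ℕ → Set (Edge α R)} {P : Set ℕ} {n : ℕ} (hP : ∀ i < n, i ∈ P)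
    (X : Set (State l)) (y : State l) :
    y ∈ orderedProd P (fun i => act l (T i)) n X ↔ ∃ ρ : List (Edge α R), ρ.length = n ∧
      (∀ δ ∈ ρ, δ ∈ l) ∧ (∃ x ∈ X, Path x.1 y.1 ρ) ∧ ∀ i δ, ρ[i]? = some δ → δ ∈ T i := by
  induction n generalizing y with
  | zero =>
    change y ∈ X ↔ _
    simpa [Path] using fun _ => y.2
  | succ n ih =>
    rw [orderedProd_succ_of_mem (hP n n.lt_succ_self), exists_length_succ_iff]
    simp only [List.forall_mem_append, List.forall_mem_singleton, path_concat,
      forall_getElem?_concat]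
    specialize ih fun i hi => hP i (hi.trans n.lt_succ_self)
    constructor
    · rintro ⟨δ, hδT, hδl, ⟨z, hz, hzδ⟩, hy⟩
      obtain ⟨ρ, rfl, hl, ⟨x, hx, hpath⟩, hT⟩ := (ih z).1 hz
      exact ⟨ρ, rfl, δ, ⟨hl, hδl⟩, ⟨x, hx, hzδ ▸ hpath, hy⟩, hT, hδT⟩
    · rintro ⟨ρ, rfl, δ, ⟨hl, hδl⟩, ⟨x, hx, hpath, hy⟩, hT, hδT⟩
      exact ⟨δ, hδT, hδl, ⟨⟨δ.1, source_mem_states hδl⟩,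
        (ih _).2 ⟨ρ, rfl, hl, ⟨x, hx, hpath⟩, hT⟩, rfl⟩, hy⟩

/-- The transitions that a run on `w` that takes the transitions `e` at the positions `t` can take
at the position `x`. -/
def allowed (w : List α) (t : List ℕ) (e : List (Edge α R)) (x : ℕ) : Set (Edge α R) :=
  {δ | some δ.2.1 = letterAt w x ∧ ∀ j < e.length, t.getD j 0 = x → some δ = e[j]?}

theorem act_allowed_mem_actions (l : List (Edge α R)) {w : List α} (t : List ℕ)
    (e : List (Edge α R)) {x : ℕ} (hx : x ∈ positions w) :
    act l (allowed w t e x) ∈ actions l := by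
  by_cases hmarked : ∃ j < e.length, t.getD j 0 = x
  · obtain ⟨j, hj, hjx⟩ := hmarked
    exact .inr ⟨_, fun δ hδ δ' hδ' => Option.some.inj
      ((hδ.2 j hj hjx).trans (hδ'.2 j hj hjx).symm), rfl⟩
  · have hletter : letterAt w x = some (w[x]'hx) := List.getElem?_eq_getElem hx
    refine .inl ⟨w[x]'hx, congrArg _ (Set.ext fun δ => ?_)⟩
    simp only [allowed, Set.mem_ofPred_eq, hletter, Option.some.injEq, and_iff_left_iff_imp]
    exact fun _ j hj hjx => absurd ⟨j, hj, hjx⟩ hmarked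

theorem WordEF.act_allowed {k : ℕ} {t t' : List ℕ} {e : List (Edge α R)}
    (h : WordEF k u v (zipSet t t')) (htt : t.length = t'.length) (het : e.length = t.length) :
    EF (positions u) (fun x => act l (allowed u t e x)) (positions v)
      (fun x => act l (allowed v t' e x)) k ∅ := by
  refine EF.restrict (r := 0) subset_rfl subset_rfl h fun s hs hEF x hx y hy hxy =>
    ⟨iff_of_true hx hy, fun _ => congrArg _ (Set.ext fun δ => ?_)⟩
  have hmark {j : ℕ} (hj : j < e.length) : t.getD j 0 = x ↔ t'.getD j 0 = y :=
    hEF.eq_iff (hs ((mem_zipSet_iff_getD htt).2 ⟨j, by omega, rfl⟩)) hxy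
  simp only [allowed, Set.mem_ofPred_eq, hEF.label_eq hxy]
  exact and_congr_right fun _ => forall₂_congr fun j hj => by rw [hmark hj]

theorem mem_orderedProd_act_allowed {w : List α} {t : List ℕ} {e : List (Edge α R)}
    (ht : ∀ j < e.length, t.getD j 0 < w.length) {x y : State l} :
    y ∈ orderedProd (positions w) (fun i => act l (allowed w t e i)) w.length {x} ↔
      ∃ ρ, Run l x.1 y.1 w ρ ∧ ∀ j < e.length, ρ[t.getD j 0]? = e[j]? := by
  refine (mem_orderedProd_act (fun _ hi => hi) _ _).trans ?_
  simp only [Set.mem_singleton_iff, exists_eq_left]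
  refine exists_congr fun ρ => ⟨fun ⟨hlen, hl, hpath, hρ⟩ => ?_, fun ⟨hρ, hmark⟩ => ?_⟩
  · have hlabel : ρ.map (fun δ => δ.2.1) = w := by
      refine List.ext_getElem? fun i => ?_
      rw [List.getElem?_map]
      rcases hi : ρ[i]? with _ | δ
      · rw [Option.map_none, List.getElem?_eq_none (hlen ▸ List.getElem?_eq_none_iff.1 hi)]
      · exact (hρ i δ hi).1
    refine ⟨⟨hl, hpath, hlabel⟩, fun j hj => ?_⟩
    have hlt : t.getD j 0 < ρ.length := hlen.symm ▸ ht j hj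
    rw [List.getElem?_eq_getElem hlt]
    exact (hρ _ _ (List.getElem?_eq_getElem hlt)).2 j hj rfl
  · refine ⟨hρ.length_eq, hρ.1, hρ.2.1, fun i δ hi => ⟨?_, fun j hj hji => ?_⟩⟩
    · rw [← hρ.2.2, letterAt, List.getElem?_map, hi, Option.map_some]
    · rw [← hmark j hj, hji, hi]

/-- A number of rounds for which the existence of runs with transitions from `l` is invariant; the
additional round makes the duplicator preserve the ends of a word. -/
def runRank (l : List (Edge α R)) : ℕ := counterFreeRank (2 ^ (2 * l.length)) + 1

theorem exists_run_of_wordEF (hl : EdgesAperiodic l) (hu : u ≠ []) {t t' : List ℕ}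
    {e : List (Edge α R)} (htt : t.length = t'.length) (het : e.length = t.length)
    (ht' : ∀ y ∈ t', y < v.length) (h : WordEF (runRank l) u v (zipSet t t'))
    (hρ : Run l p q u ρ) (hρt : ∀ i < e.length, ρ[t.getD i 0]? = e[i]?) :
    ∃ ρ', Run l p q v ρ' ∧ ∀ i < e.length, ρ'[t'.getD i 0]? = e[i]? := by
  have prod_eq := (counterFree_actions hl).efInvariant _ (card_set_state_le l)
    (P := positions u) (P' := positions v) (fun _ hx => hx)
    (fun _ hx => hx) (fun _ => act_allowed_mem_actions l t e)
    (fun _ => act_allowed_mem_actions l t' e) (WordEF.act_allowed h.of_succ htt het)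
  have ht (j : ℕ) (hj : j < e.length) : t.getD j 0 < u.length := by
    rw [← hρ.length_eq]
    exact (List.getElem?_eq_some_iff.1 ((hρt j hj).trans (List.getElem?_eq_getElem hj))).1
  have ht'e (j : ℕ) (hj : j < e.length) : t'.getD j 0 < v.length := by
    rw [List.getD_eq_getElem _ _ (by omega)]
    exact ht' _ (List.getElem_mem _)
  have hmem := (mem_orderedProd_act_allowed (x := ⟨p, hρ.source_mem hu⟩)
    (y := ⟨q, hρ.target_mem hu⟩) ht).2 ⟨ρ, hρ, hρt⟩
  rw [prod_eq] at hmem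
  exact (mem_orderedProd_act_allowed ht'e).1 hmem

end Runs

/-! ### Heights and canonical positions -/

section Enumeration

variable {X : Type*} {L t : List X} {m N : ℕ}

/-- The lists of length `m` with entries from `L`. -/
def tuples (L : List X) : ℕ → List (List X)
  | 0 => [[]]
  | m + 1 => (tuples L m).flatMap fun t => L.map fun x => t ++ [x]

theorem mem_tuples : t ∈ tuples L m ↔ t.length = m ∧ ∀ x ∈ t, x ∈ L := by
  induction m generalizing t with
  | zero => simp +contextual [tuples, List.length_eq_zero_iff]
  | succ m ih =>
    simp only [tuples, List.mem_flatMap, List.mem_map, ih]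
    constructor
    · rintro ⟨s, ⟨rfl, hs⟩, x, hx, rfl⟩
      exact ⟨List.length_append, List.forall_mem_append.2 ⟨hs, List.forall_mem_singleton.2 hx⟩⟩
    · rintro ⟨hlen, ht⟩
      cases t using List.reverseRecOn with
      | nil => simp at hlen
      | append_singleton s x =>
        rw [List.forall_mem_append, List.forall_mem_singleton] at ht
        exact ⟨s, ⟨by simpa using hlen, ht.1⟩, x, ht.2, rfl⟩

theorem nodup_tuples (hL : L.Nodup) (m : ℕ) : (tuples L m).Nodup := by
  induction m with
  | zero => exact List.nodup_singleton _
  | succ m ih =>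
    refine List.nodup_flatMap.2 ⟨fun t _ => hL.map fun x y h => by simpa using h, ?_⟩
    refine ih.imp fun {s t} hst z hs ht => ?_
    obtain ⟨x, -, rfl⟩ := List.mem_map.1 hs
    obtain ⟨y, -, hxy⟩ := List.mem_map.1 ht
    exact hst (List.append_inj_left' hxy rfl).symm

/-- The lists of length less than `N` with entries from `L`. -/
def seqs (L : List X) (N : ℕ) : List (List X) := (List.range N).flatMap (tuples L)

theorem mem_seqs : t ∈ seqs L N ↔ t.length < N ∧ ∀ x ∈ t, x ∈ L := by
  simp [seqs, mem_tuples]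

theorem exists_eq_append_of_mem_zip {Y : Type*} {L' : List Y} {x : X} {y : Y}
    (h : (x, y) ∈ L.zip L') : ∃ L₁ L₂ L₁' L₂', L = L₁ ++ x :: L₂ ∧ L' = L₁' ++ y :: L₂' ∧
      L₁.length = L₁'.length := by
  obtain ⟨Z₁, Z₂, hZ⟩ := List.append_of_mem h
  obtain ⟨L₁, L₂, L₁', L₂', hlen, rfl, rfl, -, hZ₂⟩ := List.zip_eq_append_iff.1 hZ
  obtain ⟨L₂, L₂', rfl, rfl, -⟩ := List.zip_eq_cons_iff.1 hZ₂.symm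
  exact ⟨L₁, L₂, L₁', L₂', rfl, rfl, hlen⟩

end Enumeration

section Heights

variable {α R : Type*} {l ρ ρ' : List (Edge α R)} {h : ℕ → ℕ} {p q i x y : ℕ} {u v : List α}
  {δ : Edge α R} {t t' : List ℕ} {e e' : List (Edge α R)}

theorem run_append_cons : Run l p q u (ρ ++ δ :: ρ') ↔
    Run l p δ.1 (ρ.map fun δ => δ.2.1) ρ ∧ δ ∈ l ∧
      Run l δ.2.2.1 q (ρ'.map fun δ => δ.2.1) ρ' ∧
        u = ρ.map (fun δ => δ.2.1) ++ δ.2.1 :: ρ'.map fun δ => δ.2.1 := by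
  simp only [Run, List.forall_mem_append, List.forall_mem_cons, path_append, Path, List.map_append,
    List.map_cons, and_true]
  constructor
  · rintro ⟨⟨hρ, hδ, hρ'⟩, ⟨_, hpath, rfl, hpath'⟩, rfl⟩
    exact ⟨⟨hρ, hpath⟩, hδ, ⟨hρ', hpath'⟩, rfl⟩
  · rintro ⟨⟨hρ, hpath⟩, hδ, ⟨hρ', hpath'⟩, rfl⟩
    exact ⟨⟨hρ, hδ, hρ'⟩, ⟨_, hpath, rfl, hpath'⟩, rfl⟩

/-- `h` does not decrease along transitions, and is constant only along those that can be
reversed. -/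
structure IsHeight (l : List (Edge α R)) (h : ℕ → ℕ) : Prop where
  le : ∀ δ ∈ l, h δ.1 ≤ h δ.2.2.1
  back : ∀ δ ∈ l, h δ.1 = h δ.2.2.1 → ∃ u ρ, Run l δ.2.2.1 δ.1 u ρ
  bdd : ∀ x, h x ≤ l.length

theorem IsHeight.le_source (hh : IsHeight l h) (hl : ∀ δ ∈ ρ, δ ∈ l) (hpath : Path p q ρ) :
    ∀ δ ∈ ρ, h p ≤ h δ.1 := by
  induction ρ generalizing p with
  | nil => simp
  | cons δ ρ ih =>
    obtain ⟨rfl, hpath⟩ := hpath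
    rw [List.forall_mem_cons] at hl
    exact List.forall_mem_cons.2 ⟨le_rfl, fun δ' hδ' =>
      (hh.le δ hl.1).trans (ih hl.2 hpath δ' hδ')⟩

theorem IsHeight.pairwise (hh : IsHeight l h) (hl : ∀ δ ∈ ρ, δ ∈ l) (hpath : Path p q ρ) :
    ρ.Pairwise fun δ δ' => h δ.2.2.1 ≤ h δ'.1 := by
  induction ρ generalizing p with
  | nil => exact .nil
  | cons δ ρ ih =>
    rw [List.forall_mem_cons] at hl
    exact .cons (hh.le_source hl.2 hpath.2) (ih hl.2 hpath.2)

/-- `x` is the position of the first transition of `ρ` that leads to a height greater than `i`, or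
of the last transition if there is none. -/
def IsCanonical (h : ℕ → ℕ) (ρ : List (Edge α R)) (i x : ℕ) : Prop :=
  ∃ δ ∈ ρ[x]?, (i < h δ.2.2.1 ∨ x + 1 = ρ.length) ∧ (x = 0 ∨ h δ.1 ≤ i)

theorem Path.exists_isCanonical (hρ : Path p q ρ) (hne : ρ ≠ []) (h : ℕ → ℕ) (i : ℕ) :
    ∃ x, IsCanonical h ρ i x := by
  induction ρ generalizing p with
  | nil => exact absurd rfl hne
  | cons δ ρ ih =>
    by_cases hfirst : i < h δ.2.2.1 ∨ ρ = []
    · exact ⟨0, δ, rfl, hfirst.imp_right fun hρ => by simp [hρ], .inl rfl⟩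
    · push Not at hfirst
      obtain ⟨x, δ', hx, hend, hstart⟩ := ih hρ.2 hfirst.2
      refine ⟨x + 1, δ', hx, hend.imp_right (congrArg Nat.succ), .inr ?_⟩
      rcases hstart with rfl | hle
      · cases ρ with
        | nil => simp at hx
        | cons δ₀ ρ =>
          obtain rfl : δ₀ = δ' := by simpa using hx
          exact hρ.2.1 ▸ hfirst.1
      · exact hle

theorem IsHeight.isCanonical_unique (hh : IsHeight l h) (hρ : Run l p q u ρ)
    (hx : IsCanonical h ρ i x) (hy : IsCanonical h ρ i y) : x = y := by
  suffices hlt : ∀ {x y}, IsCanonical h ρ i x → IsCanonical h ρ i y → ¬ x < y from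
    le_antisymm (not_lt.1 (hlt hy hx)) (not_lt.1 (hlt hx hy))
  rintro x y ⟨δ, hδ, hx, -⟩ ⟨δ', hδ', -, hy⟩ hxy
  obtain ⟨hxρ, rfl⟩ := List.getElem?_eq_some_iff.1 hδ
  obtain ⟨hyρ, rfl⟩ := List.getElem?_eq_some_iff.1 hδ'
  have hle := List.pairwise_iff_getElem.1 (hh.pairwise hρ.1 hρ.2.1) x y hxρ hyρ hxy
  omega

theorem IsHeight.isCanonical_of_ne (hh : IsHeight l h) (hδ : δ ∈ l) (hx : δ ∈ ρ[x]?)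
    (hne : h δ.1 ≠ h δ.2.2.1) : h δ.1 < l.length ∧ IsCanonical h ρ (h δ.1) x :=
  have hlt : h δ.1 < h δ.2.2.1 := lt_of_le_of_ne (hh.le δ hδ) hne
  ⟨hlt.trans_le (hh.bdd _), δ, hx, .inl hlt, .inr le_rfl⟩

theorem IsHeight.exists_back (hh : IsHeight l h) (hpath : Path p q ρ)
    (hρ : ∀ δ ∈ ρ, δ ∈ l ∧ h δ.1 = h δ.2.2.1) : ∃ u ρ', Run l q p u ρ' := by
  induction ρ generalizing p with
  | nil => exact ⟨[], exists_run_nil.2 hpath.symm⟩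
  | cons δ ρ ih =>
    obtain ⟨rfl, hpath⟩ := hpath
    rw [List.forall_mem_cons] at hρ
    obtain ⟨u, hu⟩ := ih hpath hρ.2
    obtain ⟨v, hv⟩ := hh.back δ hρ.1.1 hρ.1.2
    exact ⟨u ++ v, exists_run_append.2 ⟨_, hu, hv⟩⟩

-- Split both runs at a common transition; runs without one stay at a single height, hence in a
-- single strongly connected component.
theorem IsHeight.run_eq (hh : IsHeight l h) (hl : EdgesUnambiguous l) (hρ : Run l p q u ρ)
    (hρ' : Run l p q u ρ') (hzip : ∀ x ∈ ρ.zip ρ', x.1 = x.2 ∨ h x.1.1 = h x.1.2.2.1) :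
    ρ = ρ' := by
  induction hn : ρ.length using Nat.strong_induction_on generalizing p q u ρ ρ' with
  | _ n ih =>
    by_cases hcommon : ∃ δ, (δ, δ) ∈ ρ.zip ρ'
    · obtain ⟨δ, hδ⟩ := hcommon
      obtain ⟨ρ₁, ρ₂, ρ₁', ρ₂', rfl, rfl, hlen⟩ := exists_eq_append_of_mem_zip hδ
      obtain ⟨hρ₁, -, hρ₂, rfl⟩ := run_append_cons.1 hρ
      obtain ⟨hρ₁', -, hρ₂', hlabel⟩ := run_append_cons.1 hρ'
      obtain ⟨hlabel₁, hlabel₂⟩ := List.append_inj hlabel (by simp [hlen])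
      rw [List.length_append, List.length_cons] at hn
      rw [List.zip_append hlen, List.forall_mem_append, List.zip_cons_cons,
        List.forall_mem_cons] at hzip
      rw [ih _ (by omega) hρ₁ (hlabel₁ ▸ hρ₁') hzip.1 rfl,
        ih _ (by omega) hρ₂ ((List.cons_inj_right _).1 hlabel₂ ▸ hρ₂') hzip.2.2 rfl]
    · have hlevel : ∀ δ ∈ ρ, δ ∈ l ∧ h δ.1 = h δ.2.2.1 := by
        intro δ hδ
        rw [← List.map_fst_zip (hρ.length_eq.trans hρ'.length_eq.symm).le] at hδ
        obtain ⟨⟨δ, δ'⟩, hmem, rfl⟩ := List.mem_map.1 hδ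
        refine ⟨hρ.1 _ (List.of_mem_zip hmem).1, (hzip _ hmem).resolve_left fun heq => ?_⟩
        obtain rfl : δ = δ' := heq
        exact hcommon ⟨δ, hmem⟩
      exact hl p q ⟨u, ρ, hρ⟩ (hh.exists_back hρ.2.1 hlevel) u ρ ρ' hρ hρ'

/-- `ρ` takes the transitions `e` at the positions `t`, the first `J` of which are canonical. -/
def Matches (h : ℕ → ℕ) (J : ℕ) (ρ : List (Edge α R)) (t : List ℕ) (e : List (Edge α R)) : Prop :=
  (∀ i < e.length, ρ[t.getD i 0]? = e[i]?) ∧ ∀ i < J, IsCanonical h ρ i (t.getD i 0)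

theorem IsHeight.eq_of_matches (hh : IsHeight l h) (hl : EdgesUnambiguous l)
    (hρ : Run l p q u ρ) (hρ' : Run l p q u ρ') (he : l.length ≤ e.length)
    (hm : Matches h l.length ρ t e) (hm' : Matches h l.length ρ' t e) : ρ = ρ' := by
  refine hh.run_eq hl hρ hρ' fun ⟨δ, δ'⟩ hδ => or_iff_not_imp_right.2 fun hne => ?_
  obtain ⟨x, hx⟩ := List.getElem?_of_mem hδ
  obtain ⟨hδ, hδ'⟩ := List.getElem?_zip_eq_some.1 hx
  obtain ⟨hlt, hcanonical⟩ := hh.isCanonical_of_ne (hρ.1 δ (List.mem_of_getElem? hδ)) hδ hne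
  have hx : x = t.getD (h δ.1) 0 := hh.isCanonical_unique hρ hcanonical (hm.2 _ hlt)
  have heq := (hm.1 _ (hlt.trans_le he)).trans (hm'.1 _ (hlt.trans_le he)).symm
  rw [← hx, hδ, hδ'] at heq
  exact Option.some.inj heq

theorem Run.exists_matches (hρ : Run l p q u ρ) (hu : u ≠ []) (h : ℕ → ℕ) :
    ∃ t ∈ tuples (List.range u.length) l.length, ∃ e ∈ tuples l l.length,
      Matches h l.length ρ t e := by
  have hne : ρ ≠ [] := List.ne_nil_of_length_pos (hρ.length_eq ▸ List.length_pos_of_ne_nil hu)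
  choose x hx using hρ.2.1.exists_isCanonical hne h
  choose δ hδ hends using hx
  refine ⟨(List.range l.length).map x, mem_tuples.2 ⟨by simp, ?_⟩,
    (List.range l.length).map δ, mem_tuples.2 ⟨by simp, ?_⟩, fun i hi => ?_, fun i hi => ?_⟩
  · rw [List.forall_mem_map]
    exact fun i _ => List.mem_range.2 (hρ.length_eq ▸ (List.getElem?_eq_some_iff.1 (hδ i)).1)
  · rw [List.forall_mem_map]
    exact fun i _ => hρ.1 _ (List.mem_of_getElem? (hδ i))
  · rw [List.length_map, List.length_range] at hi
    simpa [hi] using hδ i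
  · have hx : IsCanonical h ρ i (x i) := ⟨δ i, hδ i, hends i⟩
    simpa [hi] using hx

theorem IsHeight.matches_unique (hh : IsHeight l h) (hρ : Run l p q u ρ)
    (ht : t.length = l.length) (ht' : t'.length = l.length) (he : e.length = l.length)
    (he' : e'.length = l.length) (hm : Matches h l.length ρ t e)
    (hm' : Matches h l.length ρ t' e') : t = t' ∧ e = e' := by
  have hpos (i : ℕ) (hi : i < l.length) : t.getD i 0 = t'.getD i 0 :=
    hh.isCanonical_unique hρ (hm.2 i hi) (hm'.2 i hi)
  constructor
  · refine List.ext_getElem (ht.trans ht'.symm) fun i hi hi' => ?_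
    simpa only [List.getD_eq_getElem _ _ hi, List.getD_eq_getElem _ _ hi'] using hpos i (ht ▸ hi)
  · refine List.ext_getElem? fun i => ?_
    by_cases hi : i < l.length
    · rw [← hm.1 i (he.symm ▸ hi), ← hm'.1 i (he'.symm ▸ hi), hpos i hi]
    · rw [List.getElem?_eq_none (by omega), List.getElem?_eq_none (by omega)]

/-- A bound for the lengths of representatives of all pointed words with at most `l.length + 1`
marked positions. -/
def shortBound (l : List (Edge α R)) : ℕ :=
  wordTypeCount l.length (runRank l + (l.length + 1)) (runRank l + (l.length + 1))

theorem Run.letter_mem (hρ : Run l p q u ρ) : ∀ a ∈ u, a ∈ l.map fun δ => δ.2.1 := by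
  obtain ⟨hl, -, rfl⟩ := hρ
  exact List.forall_mem_map.2 fun δ hδ => List.mem_map_of_mem (hl δ hδ)

theorem exists_short_points (hu : ∀ a ∈ u, a ∈ l.map fun δ => δ.2.1)
    (ht : ∀ x ∈ t, x < u.length) (htl : t.length ≤ l.length + 1) :
    ∃ (v : List α) (t' : List ℕ), v.length < shortBound l ∧ t'.length = t.length ∧
      (∀ y ∈ t', y < v.length) ∧ WordEF (runRank l) u v (zipSet t t') := by
  obtain ⟨v, -, hv, hEF⟩ := exists_short_wordEF_of_letters (runRank l + (l.length + 1)) hu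
  rw [List.length_map] at hv
  obtain ⟨t', hlen, ht', hEF'⟩ :=
    EF.exists_tuple (k := runRank l) t (hEF.of_le (by omega)) ht
  exact ⟨v, t', hv, hlen, ht', by simpa using hEF'⟩

theorem WordEF.ne_nil {k : ℕ} {s : Set (ℕ × ℕ)} (hEF : WordEF k u v s) (hk : 1 ≤ k)
    (hu : u ≠ []) : v ≠ [] := by
  obtain ⟨y, hy, -⟩ := (EF.of_le hEF hk).2.1 0 (List.length_pos_of_ne_nil hu)
  exact List.ne_nil_of_length_pos (Nat.zero_lt_of_lt hy)

theorem WordEF.ends {k : ℕ} {s : Set (ℕ × ℕ)} (hEF : WordEF k u v s) (hk : 1 ≤ k)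
    (hxy : (x, y) ∈ s) (hy : y < v.length) :
    (x = 0 → y = 0) ∧ (x + 1 = u.length → y + 1 = v.length) := by
  have reply := (EF.of_le hEF hk).2.2
  constructor
  · rintro rfl
    by_contra hy0
    obtain ⟨x', -, hEF'⟩ := reply 0 (show 0 < v.length by omega)
    have hlt := hEF'.lt_iff (Set.mem_insert _ _) (Set.mem_insert_of_mem _ hxy)
    omega
  · intro hx
    by_contra hylast
    obtain ⟨x', hx' : x' < u.length, hEF'⟩ := reply (y + 1) (show y + 1 < v.length by omega)
    have hlt := hEF'.lt_iff (Set.mem_insert_of_mem _ hxy) (Set.mem_insert _ _)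
    omega

theorem exists_matches_of_wordEF (hl : EdgesAperiodic l) (hu : u ≠ [])
    (htt : t.length = t'.length) (het : e.length = t.length) (ht' : ∀ y ∈ t', y < v.length)
    (hEF : WordEF (runRank l) u v (zipSet t t')) (hρ : Run l p q u ρ) {J : ℕ}
    (hJ : J ≤ e.length) (hm : Matches h J ρ t e) :
    ∃ ρ', Run l p q v ρ' ∧ Matches h J ρ' t' e := by
  obtain ⟨ρ', hρ', hmark⟩ := exists_run_of_wordEF hl hu htt het ht' hEF hρ hm.1
  refine ⟨ρ', hρ', hmark, fun i hi => ?_⟩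
  have hie : i < e.length := hi.trans_le hJ
  have hends := WordEF.ends hEF (Nat.le_add_left 1 _)
    ((mem_zipSet_iff_getD htt).2 ⟨i, het ▸ hie, rfl⟩)
    (ht' _ (by rw [List.getD_eq_getElem _ _ (by omega)]; exact List.getElem_mem _))
  obtain ⟨δ, hδ, hend, hstart⟩ := hm.2 i hi
  rw [hρ.length_eq] at hend
  rw [← hρ'.length_eq] at hends
  exact ⟨δ, (hmark i hie).trans ((hm.1 i hie).symm.trans hδ), hend.imp_right hends.2,
    hstart.imp_left hends.1⟩

/-- One step of reading a path; the state is `none` after a failure. -/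
def stepState (s : Option ℕ) (δ : Edge α R) : Option ℕ :=
  if s = some δ.1 then some δ.2.2.1 else none

/-- The end of the path `ρ` from `p`, or `none` if `ρ` is not a path from `p`. -/
def pathEnd (p : ℕ) (ρ : List (Edge α R)) : Option ℕ := ρ.foldl stepState (some p)

theorem foldl_stepState_none (ρ : List (Edge α R)) : ρ.foldl stepState none = none := by
  induction ρ with
  | nil => rfl
  | cons _ _ ih => exact ih

theorem pathEnd_eq_some : pathEnd p ρ = some q ↔ Path p q ρ := by
  induction ρ generalizing p with
  | nil => exact Option.some_inj
  | cons δ ρ ih =>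
    by_cases hp : p = δ.1
    · subst hp
      simpa [pathEnd, stepState, Path] using ih
    · simp [pathEnd, stepState, Path, hp, Ne.symm hp, foldl_stepState_none]

/-- There is a path from `x` to `y` of length less than `shortBound l`. -/
def Reach (l : List (Edge α R)) (x y : ℕ) : Prop :=
  ∃ ρ ∈ seqs l (shortBound l), pathEnd x ρ = some y

theorem reach_iff (hl : EdgesAperiodic l) : Reach l x y ↔ ∃ u ρ, Run l x y u ρ := by
  simp only [Reach, mem_seqs, pathEnd_eq_some]
  constructor
  · rintro ⟨ρ, ⟨-, hρ⟩, hpath⟩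
    exact ⟨_, ρ, hρ, hpath, rfl⟩
  · rintro ⟨u, ρ, hρ⟩
    obtain ⟨v, t', hv, ht', -, hEF⟩ := exists_short_points (t := []) hρ.letter_mem (by simp)
      (by simp)
    obtain rfl := List.length_eq_zero_iff.1 ht'
    by_cases hu : u = []
    · subst hu
      exact ⟨[], ⟨Nat.zero_lt_of_lt hv, by simp⟩, exists_run_nil.1 ⟨ρ, hρ⟩⟩
    · obtain ⟨ρ', hρ', -⟩ := exists_run_of_wordEF hl hu (e := []) rfl rfl (by simp) hEF hρ
        (by simp)
      exact ⟨ρ', ⟨hρ'.length_eq ▸ hv, hρ'.1⟩, hρ'.2.1⟩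

open Classical in
/-- The number of transitions whose source cannot be reached from `x`. -/
noncomputable def height (l : List (Edge α R)) (x : ℕ) : ℕ :=
  (l.filter fun δ => ¬ Reach l x δ.1).length

theorem reach_of_reach_target (hl : EdgesAperiodic l) (hδ : δ ∈ l) (h : Reach l δ.2.2.1 x) :
    Reach l δ.1 x := by
  obtain ⟨u, hu⟩ := (reach_iff hl).1 h
  have hδ' : Run l δ.1 δ.2.2.1 [δ.2.1] [δ] := ⟨by simpa using hδ, ⟨rfl, rfl⟩, rfl⟩
  exact (reach_iff hl).2 ⟨_, exists_run_append.2 ⟨_, ⟨_, hδ'⟩, hu⟩⟩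

open Classical in
theorem isHeight_height (hl : EdgesAperiodic l) : IsHeight l (height l) := by
  have hsub (δ) (hδ : δ ∈ l) : (l.filter fun δ' => ¬ Reach l δ.1 δ'.1).Sublist
      (l.filter fun δ' => ¬ Reach l δ.2.2.1 δ'.1) :=
    List.monotone_filter_right l fun δ' => by simpa using mt (reach_of_reach_target hl hδ)
  refine ⟨fun δ hδ => (hsub δ hδ).length_le, fun δ hδ heq => (reach_iff hl).1 ?_,
    fun x => List.length_filter_le _ _⟩
  by_contra hback
  have hmem : δ ∈ l.filter fun δ' => ¬ Reach l δ.1 δ'.1 := by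
    rw [(hsub δ hδ).eq_of_length heq]
    simpa [hδ] using hback
  have hunreachable : ¬ Reach l δ.1 δ.1 := by simpa [hδ] using hmem
  exact hunreachable ((reach_iff hl).2 ⟨[], exists_run_nil.2 rfl⟩)

end Heights

/-! ### Weighted formulas for the runs -/

theorem StepFO.sem_foldr_ite {α R X : Type*} {u : List α} {σ : ℕ → Fin u.length} {φ : X → FO α}
    {w : X → R} {r : R} {x : X} (hφ : ∀ y, FO.Sat u σ (φ y) ↔ y = x) {L : List X} (hx : x ∈ L) :
    (L.foldr (fun y Ψ => ite (φ y) (const (w y)) Ψ) (const r)).sem u σ = w x := by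
  induction L with
  | nil => simp at hx
  | cons y L ih =>
    rw [List.foldr_cons, StepFO.sem]
    split_ifs with hy
    · rw [StepFO.sem, (hφ y).1 hy]
    · exact ih ((List.mem_cons.1 hx).resolve_left fun h => hy ((hφ y).2 h.symm))

theorem StepFO.fv_foldr_ite_subset {α R X : Type*} {φ : X → FO α} {w : X → R} {r : R} {V : Set ℕ}
    (hφ : ∀ y, (φ y).fv ⊆ V) (L : List X) :
    (L.foldr (fun y Ψ => ite (φ y) (const (w y)) Ψ) (const r)).fv ⊆ V := by
  induction L with
  | nil => exact Set.empty_subset V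
  | cons y L ih => exact Set.union_subset (Set.union_subset (hφ y) (Set.empty_subset V)) ih

namespace WFO

variable {α R : Type*} {u : List α}

/-- The sum of a list of formulas. -/
def sumList : List (WFO α R) → WFO α R
  | [] => zero
  | Φ :: L => add Φ (sumList L)

theorem sem_sumList (σ : ℕ → Fin u.length) (L : List (WFO α R)) :
    (sumList L).sem u σ = (L.map fun Φ => Φ.sem u σ).sum := by
  induction L with
  | nil => rfl
  | cons Φ L ih => rw [sumList, sem, ih, List.map_cons, List.sum_cons]

theorem fv_sumList {L : List (WFO α R)} (h : ∀ Φ ∈ L, Φ.fv = ∅) : (sumList L).fv = ∅ := by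
  induction L with
  | nil => rfl
  | cons Φ L ih =>
    rw [List.forall_mem_cons] at h
    rw [sumList, fv, h.1, ih h.2, Set.union_empty]

/-- The sum over the variables `0, …, j - 1`. -/
def sumVars : ℕ → WFO α R → WFO α R
  | 0, Φ => Φ
  | j + 1, Φ => sumVars j (sum j Φ)

theorem fv_sumVars {j : ℕ} {Φ : WFO α R} (h : Φ.fv ⊆ {i | i < j}) : (sumVars j Φ).fv = ∅ := by
  induction j generalizing Φ with
  | zero => exact Set.subset_empty_iff.1 fun i hi => absurd (h hi) (Nat.not_lt_zero i)
  | succ j ih => exact ih fun i hi => lt_of_le_of_ne (Nat.le_of_lt_succ (h hi.1)) hi.2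

/-- The valuation that agrees with `t` on the first variables, and with `σ` on the others. -/
def assign {n : ℕ} (σ : ℕ → Fin n) (t : List (Fin n)) (i : ℕ) : Fin n := t[i]?.getD (σ i)

theorem assign_nil {n : ℕ} (σ : ℕ → Fin n) : assign σ [] = σ := rfl

theorem update_assign {n : ℕ} (σ : ℕ → Fin n) (t : List (Fin n)) (x : Fin n) :
    Function.update (assign σ t) t.length x = assign σ (t ++ [x]) := by
  funext i
  rcases lt_trichotomy i t.length with h | rfl | h
  · rw [Function.update_of_ne h.ne, assign, assign, List.getElem?_append_left h]
  · simp [assign]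
  · rw [Function.update_of_ne h.ne', assign, assign, List.getElem?_eq_none h.le,
      List.getElem?_eq_none (by simpa using h)]

theorem vals_assign (σ : ℕ → Fin u.length) (t : List (Fin u.length)) :
    FO.vals (assign σ t) t.length = t.map Fin.val := by
  refine List.ext_getElem (by simp) fun i hi hi' => ?_
  rw [List.length_map] at hi'
  simp [FO.vals, assign, hi']

theorem sem_sumVars (σ : ℕ → Fin u.length) (j : ℕ) (Φ : WFO α R) : (sumVars j Φ).sem u σ =
    ((tuples (List.finRange u.length) j).map fun t => Φ.sem u (assign σ t)).sum := by
  induction j generalizing Φ with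
  | zero => simp [sumVars, tuples, assign_nil]
  | succ j ih =>
    rw [sumVars, ih, tuples, List.map_flatMap, List.flatMap_def, List.sum_flatten, List.map_map]
    refine congrArg List.sum (List.map_congr_left fun t ht => ?_)
    rw [Function.comp_apply, List.map_map, sem, Fin.sum_univ_def, ← (mem_tuples.1 ht).1]
    exact congrArg List.sum (List.map_congr_left fun x _ =>
      congrArg (sem u · Φ) (update_assign σ t x))

end WFO

section Formulas

variable {α R : Type*} {l : List (Edge α R)} {p q : ℕ} {e : List (Edge α R)} {u : List α}

/-- The first component is a nonempty path from `p` to `q` that takes the transitions `e` at the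
positions given by the second component, the first `l.length` of which are canonical. -/
def Witness (l : List (Edge α R)) (p q : ℕ) (e : List (Edge α R))
    (x : List (Edge α R) × List ℕ) : Prop :=
  x.1 ≠ [] ∧ pathEnd p x.1 = some q ∧ Matches (height l) l.length x.1 x.2 e

/-- The sequences of transitions of length less than `shortBound l`, with `d` marked positions. -/
def pointedSeqs (l : List (Edge α R)) (d : ℕ) : List (List (Edge α R) × List ℕ) :=
  (seqs l (shortBound l)).flatMap fun ρ => (tuples (List.range ρ.length) d).map (Prod.mk ρ)

theorem mem_pointedSeqs {d : ℕ} {x : List (Edge α R) × List ℕ} : x ∈ pointedSeqs l d ↔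
    (x.1.length < shortBound l ∧ ∀ δ ∈ x.1, δ ∈ l) ∧
      x.2.length = d ∧ ∀ y ∈ x.2, y < x.1.length := by
  obtain ⟨ρ, t⟩ := x
  simp [pointedSeqs, mem_seqs, mem_tuples]

open Classical in
/-- Some run from `p` to `q` takes the transitions `e` at the positions given by the first
variables, and the first `l.length` of these positions are canonical. -/
noncomputable def runFormula (l : List (Edge α R)) (p q : ℕ) (e : List (Edge α R)) : FO α :=
  FO.disj (((pointedSeqs l e.length).filter fun x => Witness l p q e x).map fun x =>
    FO.hintikka (x.1.map fun δ => δ.2.1) (runRank l) x.2)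

/-- The weight of the transition at the position given by the variable `e.length`, in the run that
`runFormula l p q e` is about. -/
noncomputable def weightFormula (l : List (Edge α R)) (p q : ℕ) (e : List (Edge α R))
    (r : R) : StepFO α R :=
  l.foldr (fun δ Ψ => StepFO.ite (runFormula l p q (e ++ [δ])) (StepFO.const δ.2.2.2) Ψ)
    (StepFO.const r)

/-- The weight sequence of the run that `runFormula l p q e` is about, if there is one. -/
noncomputable def matchFormula (l : List (Edge α R)) (p q : ℕ) (e : List (Edge α R))
    (r : R) : WFO α R :=
  WFO.ite (runFormula l p q e) (WFO.prod e.length (weightFormula l p q e r)) WFO.zero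

/-- The weight sequences of all runs from `p` to `q`. -/
noncomputable def pairFormula (l : List (Edge α R)) (p q : ℕ) : WFO α R :=
  l.head?.elim WFO.zero fun δ => WFO.sumList <| (tuples l l.length).map fun e =>
    WFO.sumVars l.length (matchFormula l p q e δ.2.2.2)

theorem fv_runFormula_subset (l : List (Edge α R)) (p q : ℕ) (e : List (Edge α R)) :
    (runFormula l p q e).fv ⊆ {i | i < e.length} := by
  refine FO.fv_disj_subset fun φ hφ => ?_
  obtain ⟨x, hx, rfl⟩ := List.mem_map.1 hφ
  rw [← (mem_pointedSeqs.1 (List.mem_filter.1 hx).1).2.1]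
  exact FO.fv_hintikka_subset _ _ _

theorem fv_matchFormula_subset (l : List (Edge α R)) (p q : ℕ) (e : List (Edge α R)) (r : R) :
    (matchFormula l p q e r).fv ⊆ {i | i < e.length} := by
  have hweight : (weightFormula l p q e r).fv ⊆ {i | i < e.length + 1} :=
    StepFO.fv_foldr_ite_subset (fun δ => by simpa using fv_runFormula_subset l p q (e ++ [δ])) l
  refine Set.union_subset (Set.union_subset (fv_runFormula_subset l p q e) ?_)
    (Set.empty_subset _)
  exact fun i hi => lt_of_le_of_ne (Nat.le_of_lt_succ (hweight hi.1)) hi.2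

theorem isSentence_pairFormula (l : List (Edge α R)) (p q : ℕ) :
    (pairFormula l p q).IsSentence := by
  unfold pairFormula WFO.IsSentence
  cases l.head? with
  | none => rfl
  | some δ =>
    refine WFO.fv_sumList fun Φ hΦ => ?_
    obtain ⟨e, he, rfl⟩ := List.mem_map.1 hΦ
    exact WFO.fv_sumVars ((mem_tuples.1 he).1 ▸ fv_matchFormula_subset l p q e _)

open Classical in
theorem sat_runFormula (hl : EdgesAperiodic l) (hle : l.length ≤ e.length)
    (hel : e.length ≤ l.length + 1) (σ : ℕ → Fin u.length) :
    FO.Sat u σ (runFormula l p q e) ↔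
      ∃ ρ, Run l p q u ρ ∧ Matches (height l) l.length ρ (FO.vals σ e.length) e := by
  have hvals : ∀ y ∈ FO.vals σ e.length, y < u.length := by
    rw [FO.vals, List.forall_mem_map]
    exact fun i _ => (σ i).2
  rw [runFormula, FO.sat_disj]
  constructor
  · rintro ⟨φ, hφ, hsat⟩
    obtain ⟨⟨ρ, t⟩, hx, rfl⟩ := List.mem_map.1 hφ
    obtain ⟨hmem, hwitness⟩ := List.mem_filter.1 hx
    obtain ⟨⟨-, hρl⟩, ht, htρ⟩ := mem_pointedSeqs.1 hmem
    obtain ⟨hne, hpath, hm⟩ := of_decide_eq_true hwitness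
    rw [FO.sat_hintikka (by simpa using htρ), ht] at hsat
    exact exists_matches_of_wordEF hl (by simpa using hne) (by simp [ht]) ht.symm hvals hsat
      ⟨hρl, pathEnd_eq_some.1 hpath, rfl⟩ hle hm
  · rintro ⟨ρ, hρ, hm⟩
    have hu : u ≠ [] := List.ne_nil_of_length_pos (Fin.pos (σ 0))
    obtain ⟨v, t, hv, ht, htv, hEF⟩ := exists_short_points hρ.letter_mem hvals (by simpa using hel)
    rw [FO.length_vals] at ht
    obtain ⟨ρ', hρ', hm'⟩ :=
      exists_matches_of_wordEF hl hu (by simp [ht]) (by simp) htv hEF hρ hle hm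
    have hne : ρ' ≠ [] := List.ne_nil_of_length_pos <| hρ'.length_eq ▸
      List.length_pos_of_ne_nil (hEF.ne_nil (Nat.le_add_left 1 _) hu)
    refine ⟨_, List.mem_map_of_mem (a := (ρ', t)) (List.mem_filter.2 ⟨mem_pointedSeqs.2 ?_,
      decide_eq_true ⟨hne, pathEnd_eq_some.2 hρ'.2.1, hm'⟩⟩), ?_⟩
    · exact ⟨⟨hρ'.length_eq ▸ hv, hρ'.1⟩, ht, hρ'.length_eq ▸ htv⟩
    · rw [hρ'.2.2, FO.sat_hintikka htv, ht, ← swap_preimage_zipSet]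
      exact EF.symm hEF

theorem matches_concat {h : ℕ → ℕ} {J x : ℕ} {ρ : List (Edge α R)} {t : List ℕ} {δ : Edge α R}
    (hJ : J ≤ e.length) (ht : t.length = e.length) :
    Matches h J ρ (t ++ [x]) (e ++ [δ]) ↔ Matches h J ρ t e ∧ ρ[x]? = some δ := by
  have hinit {i : ℕ} (hi : i < e.length) : (t ++ [x]).getD i 0 = t.getD i 0 :=
    List.getD_append _ _ _ _ (ht ▸ hi)
  have hlast : (t ++ [x]).getD e.length 0 = x := by simp [← ht]
  simp only [Matches, List.length_append, List.length_singleton, Nat.forall_lt_succ_right, hlast,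
    List.getElem?_concat_length]
  rw [and_right_comm]
  refine and_congr_left' (and_congr (forall₂_congr fun i hi => ?_) (forall₂_congr fun i hi => ?_))
  · rw [hinit hi, List.getElem?_append_left hi]
  · rw [hinit (hi.trans_le hJ)]

theorem sat_runFormula_concat (hl : EdgesAperiodic l) (hun : EdgesUnambiguous l)
    (he : e.length = l.length) {σ : ℕ → Fin u.length} {ρ : List (Edge α R)} (hρ : Run l p q u ρ)
    (hm : Matches (height l) l.length ρ (FO.vals σ e.length) e) (x : Fin u.length)
    (δ : Edge α R) :
    FO.Sat u (Function.update σ e.length x) (runFormula l p q (e ++ [δ])) ↔ ρ[x.1]? = some δ := by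
  rw [sat_runFormula hl (by simp [he]) (by simp [he]), List.length_append, List.length_singleton,
    FO.vals_update]
  simp only [matches_concat he.ge (FO.length_vals _)]
  constructor
  · rintro ⟨ρ', hρ', hm', hx⟩
    rwa [(isHeight_height hl).eq_of_matches hun hρ hρ' he.ge hm hm']
  · exact fun hx => ⟨ρ, hρ, hm, hx⟩

theorem sem_weightFormula (hl : EdgesAperiodic l) (hun : EdgesUnambiguous l)
    (he : e.length = l.length) (r : R) {σ : ℕ → Fin u.length} {ρ : List (Edge α R)}
    (hρ : Run l p q u ρ) (hm : Matches (height l) l.length ρ (FO.vals σ e.length) e)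
    (x : Fin u.length) : (weightFormula l p q e r).sem u (Function.update σ e.length x) =
      (ρ[x.1]'(x.2.trans_eq hρ.length_eq.symm)).2.2.2 := by
  have hx : x.1 < ρ.length := x.2.trans_eq hρ.length_eq.symm
  refine StepFO.sem_foldr_ite (w := fun δ : Edge α R => δ.2.2.2) (fun δ => ?_)
    (hρ.1 _ (List.getElem_mem hx))
  rw [sat_runFormula_concat hl hun he hρ hm, List.getElem?_eq_getElem hx, Option.some_inj,
    eq_comm]

open Classical in
theorem sem_matchFormula (hl : EdgesAperiodic l) (hun : EdgesUnambiguous l)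
    (he : e.length = l.length) (r : R) (σ : ℕ → Fin u.length) {S : Finset (List (Edge α R))}
    (hS : ∀ ρ, ρ ∈ S ↔ Run l p q u ρ) : (matchFormula l p q e r).sem u σ =
      ∑ ρ ∈ S, if Matches (height l) l.length ρ (FO.vals σ e.length) e then
        {ρ.map fun δ => δ.2.2.2} else 0 := by
  rw [matchFormula, WFO.sem, sat_runFormula hl he.ge (by omega)]
  split_ifs with hex
  · obtain ⟨ρ, hρ, hm⟩ := hex
    rw [Finset.sum_eq_single_of_mem ρ ((hS ρ).2 hρ), if_pos hm, WFO.sem]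
    · refine congrArg _ (List.ext_getElem (by simp [hρ.length_eq]) fun i hi _ => ?_)
      rw [List.length_ofFn] at hi
      rw [List.getElem_ofFn, List.getElem_map]
      exact sem_weightFormula hl hun he r hρ hm ⟨i, hi⟩
    · exact fun ρ' hρ' hne => if_neg fun hm' =>
        hne ((isHeight_height hl).eq_of_matches hun ((hS ρ').1 hρ') hρ he.ge hm' hm)
  · exact (Finset.sum_eq_zero fun ρ hρ => if_neg fun hm => hex ⟨ρ, (hS ρ).1 hρ, hm⟩).symm

theorem IsHeight.exists_matches_iff {h : ℕ → ℕ} (hh : IsHeight l h) {ρ : List (Edge α R)}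
    (hρ : Run l p q u ρ) (hu : u ≠ []) :
    ∃ e ∈ tuples l l.length, ∃ t ∈ tuples (List.finRange u.length) l.length,
      ∀ e' ∈ tuples l l.length, ∀ t' ∈ tuples (List.finRange u.length) l.length,
        Matches h l.length ρ (t'.map Fin.val) e' ↔ e' = e ∧ t' = t := by
  obtain ⟨t, ht, e, he, hm⟩ := hρ.exists_matches hu h
  obtain ⟨htl, htu⟩ := mem_tuples.1 ht
  lift t to List (Fin u.length) using fun x hx => List.mem_range.1 (htu x hx)
  rw [List.length_map] at htl
  refine ⟨e, he, t, mem_tuples.2 ⟨htl, fun x _ => List.mem_finRange x⟩, fun e' he' t' ht' => ?_⟩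
  constructor
  · intro hm'
    obtain ⟨htt, hee⟩ := hh.matches_unique hρ (by simpa using (mem_tuples.1 ht').1)
      (by simpa using htl) (mem_tuples.1 he').1 (mem_tuples.1 he).1 hm' hm
    exact ⟨hee, List.map_injective_iff.2 Fin.val_injective htt⟩
  · rintro ⟨rfl, rfl⟩
    exact hm

open Classical in
theorem sem_sumVars_matchFormula (hl : EdgesAperiodic l) (hun : EdgesUnambiguous l)
    (he : e.length = l.length) (r : R) (σ : ℕ → Fin u.length) {S : Finset (List (Edge α R))}
    (hS : ∀ ρ, ρ ∈ S ↔ Run l p q u ρ) :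
    (WFO.sumVars l.length (matchFormula l p q e r)).sem u σ =
      ∑ t ∈ (tuples (List.finRange u.length) l.length).toFinset, ∑ ρ ∈ S,
        if Matches (height l) l.length ρ (t.map Fin.val) e then
          {ρ.map fun δ => δ.2.2.2} else 0 := by
  rw [WFO.sem_sumVars, List.sum_toFinset _ (nodup_tuples (List.nodup_finRange _) _)]
  refine congrArg List.sum (List.map_congr_left fun t ht => ?_)
  rw [sem_matchFormula hl hun he r _ hS, he, ← (mem_tuples.1 ht).1, WFO.vals_assign]

open Classical in
theorem sem_pairFormula (hl : EdgesAperiodic l) (hun : EdgesUnambiguous l) (hnd : l.Nodup)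
    (σ : ℕ → Fin u.length) {S : Finset (List (Edge α R))} (hS : ∀ ρ, ρ ∈ S ↔ Run l p q u ρ) :
    (pairFormula l p q).sem u σ = S.val.map fun ρ => ρ.map fun δ => δ.2.2.2 := by
  have hu : u ≠ [] := List.ne_nil_of_length_pos (Fin.pos (σ 0))
  set T := (tuples (List.finRange u.length) l.length).toFinset
  set E := (tuples l l.length).toFinset
  set weights : List (Edge α R) → Multiset (List R) := fun ρ => {ρ.map fun δ => δ.2.2.2}
  have hsum : (pairFormula l p q).sem u σ = ∑ e ∈ E, ∑ t ∈ T, ∑ ρ ∈ S,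
      if Matches (height l) l.length ρ (t.map Fin.val) e then weights ρ else 0 := by
    rcases hhead : l.head? with _ | δ
    · obtain rfl := List.head?_eq_none_iff.1 hhead
      have hS : S = ∅ := Finset.eq_empty_of_forall_notMem fun ρ hρ => by
        simpa [states] using ((hS ρ).1 hρ).source_mem hu
      simp [pairFormula, WFO.sem, hS]
    · rw [pairFormula, hhead, Option.elim_some, WFO.sem_sumList, List.map_map,
        List.sum_toFinset _ (nodup_tuples hnd _)]
      exact congrArg List.sum (List.map_congr_left fun e he =>
        sem_sumVars_matchFormula hl hun (mem_tuples.1 he).1 _ σ hS)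
  calc (pairFormula l p q).sem u σ = ∑ ρ ∈ S, ∑ e ∈ E, ∑ t ∈ T,
        if Matches (height l) l.length ρ (t.map Fin.val) e then weights ρ else 0 := by
        rw [hsum]
        exact (Finset.sum_congr rfl fun e _ => Finset.sum_comm).trans Finset.sum_comm
    _ = ∑ ρ ∈ S, weights ρ := by
        refine Finset.sum_congr rfl fun ρ hρ => ?_
        obtain ⟨e, he, t, ht, hm⟩ := (isHeight_height hl).exists_matches_iff ((hS ρ).1 hρ) hu
        rw [Finset.sum_congr rfl fun e' he' => Finset.sum_congr rfl fun t' ht' =>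
          if_congr (hm e' (List.mem_toFinset.1 he') t' (List.mem_toFinset.1 ht')) rfl rfl]
        simp [ite_and, he, ht]
    _ = S.val.map fun ρ => ρ.map fun δ => δ.2.2.2 := by
        rw [← Multiset.sum_map_singleton (S.val.map _), Multiset.map_map]
        rfl

end Formulas

/-! ### From automata to lists of transitions -/

section Listing

variable {α R Q : Type*} {A : WAut α R Q} {S : Set Q} {ι : Q → ℕ} {l : List (Edge α R)}
  {p q : Q} {u : List α}

/-- The weighted transition for a transition of an automaton whose states are numbered by `ι`. -/
def edgeOf (A : WAut α R Q) (ι : Q → ℕ) (δ : A.Tr) : Edge α R :=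
  (ι δ.1.1, δ.1.2.1, ι δ.1.2.2, A.wgt δ)

/-- `l` lists the weighted transitions of `A`, where `ι` numbers the states in `S`. Only the states
that occur in transitions have to be in `S`, so that `A` may have infinitely many states. -/
structure Listing (A : WAut α R Q) (S : Set Q) (ι : Q → ℕ) (l : List (Edge α R)) : Prop where
  injOn : S.InjOn ι
  source_mem (δ : A.Tr) : δ.1.1 ∈ S
  target_mem (δ : A.Tr) : δ.1.2.2 ∈ S
  mem_iff (e : Edge α R) : e ∈ l ↔ ∃ δ, edgeOf A ι δ = e

theorem WAut.ListedBy.listing {n : ℕ} {A : WAut α R (Fin n)} (h : A.ListedBy l) :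
    Listing A Set.univ Fin.val l where
  injOn := Fin.val_injective.injOn
  source_mem _ := Set.mem_univ _
  target_mem _ := Set.mem_univ _
  mem_iff := by
    rintro ⟨x, a, y, r⟩
    simp only [h x a y r, edgeOf, Subtype.exists, Prod.exists, Prod.mk.injEq]
    constructor
    · rintro ⟨p, q, htrans, rfl, rfl, rfl⟩
      exact ⟨p, a, q, htrans, rfl, rfl, rfl, rfl⟩
    · rintro ⟨p, a, q, htrans, rfl, rfl, rfl, rfl⟩
      exact ⟨p, q, htrans, rfl, rfl, rfl⟩

theorem exists_listing (A : WAut α R Q) (hS : S.Countable) (hsource : ∀ δ : A.Tr, δ.1.1 ∈ S)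
    (htarget : ∀ δ : A.Tr, δ.1.2.2 ∈ S) : ∃ ι l, Listing A S ι l := by
  obtain ⟨ι, hι⟩ := Set.countable_iff_exists_injOn.1 hS
  exact ⟨ι, A.trans.attach.toList.map (edgeOf A ι), hι, hsource, htarget, by simp⟩

theorem exists_listing_superset (A : WAut α R Q) (T : Finset Q) :
    ∃ S ι l, Listing A S ι l ∧ ∀ p ∈ T, p ∈ S := by
  classical
  let S := T ∪ (A.trans.image (fun t => t.1) ∪ A.trans.image fun t => t.2.2)
  obtain ⟨ι, l, h⟩ := exists_listing A (S := S) S.countable_toSet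
    (fun δ => Finset.mem_union_right _ <| Finset.mem_union_left _ <|
      Finset.mem_image_of_mem _ δ.2)
    (fun δ => Finset.mem_union_right _ <| Finset.mem_union_right _ <|
      Finset.mem_image_of_mem (fun t => t.2.2) δ.2)
  exact ⟨S, ι, l, h, fun p hp => Finset.mem_union_left _ hp⟩

namespace Listing

theorem dedup [DecidableEq (Edge α R)] (hL : Listing A S ι l) : Listing A S ι l.dedup :=
  { hL with mem_iff := fun e => List.mem_dedup.trans (hL.mem_iff e) }

theorem edgeOf_injective (hL : Listing A S ι l) : Function.Injective (edgeOf A ι) := by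
  rintro δ δ' h
  simp only [edgeOf, Prod.mk.injEq] at h
  exact Subtype.ext (Prod.ext (hL.injOn (hL.source_mem δ) (hL.source_mem δ') h.1)
    (Prod.ext h.2.1 (hL.injOn (hL.target_mem δ) (hL.target_mem δ') h.2.2.1)))

theorem path_map_edgeOf (hL : Listing A S ι l) (hp : p ∈ S) (hq : q ∈ S) {ρ : List A.Tr} :
    Path (ι p) (ι q) (ρ.map (edgeOf A ι)) ↔ A.IsRun p q ρ := by
  induction ρ generalizing p with
  | nil => exact hL.injOn.eq_iff hp hq
  | cons δ ρ ih => exact and_congr (hL.injOn.eq_iff (hL.source_mem δ) hp) (ih (hL.target_mem δ))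

theorem run_iff (hL : Listing A S ι l) (hp : p ∈ S) (hq : q ∈ S) {ρ : List (Edge α R)} :
    Run l (ι p) (ι q) u ρ ↔ ∃ ρ' ∈ A.runs p q u, ρ'.map (edgeOf A ι) = ρ := by
  constructor
  · rintro ⟨hl, hpath, hlabel⟩
    obtain ⟨ρ', rfl⟩ : ρ ∈ Set.range (List.map (edgeOf A ι)) := by
      rw [Set.range_list_map]
      exact fun δ hδ => (hL.mem_iff δ).1 (hl δ hδ)
    exact ⟨ρ', ⟨(hL.path_map_edgeOf hp hq).1 hpath, by rw [← hlabel, List.map_map]; rfl⟩, rfl⟩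
  · rintro ⟨ρ', ⟨hrun, hlabel⟩, rfl⟩
    exact ⟨List.forall_mem_map.2 fun δ _ => (hL.mem_iff _).2 ⟨δ, rfl⟩,
      (hL.path_map_edgeOf hp hq).2 hrun, by rw [← hlabel, List.map_map]; rfl⟩

theorem exists_run_iff (hL : Listing A S ι l) (hp : p ∈ S) (hq : q ∈ S) :
    (∃ ρ, Run l (ι p) (ι q) u ρ) ↔ u ∈ A.lang p q := by
  simp only [hL.run_iff hp hq]
  exact ⟨fun ⟨_, ρ, hρ, _⟩ => ⟨ρ, hρ⟩, fun ⟨ρ, hρ⟩ => ⟨_, ρ, hρ, rfl⟩⟩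

theorem exists_of_mem_states (hL : Listing A S ι l) {x : ℕ} (hx : x ∈ states l) :
    ∃ p ∈ S, ι p = x := by
  rcases List.mem_append.1 hx with h | h <;> obtain ⟨e, he, rfl⟩ := List.mem_map.1 h <;>
    obtain ⟨δ, rfl⟩ := (hL.mem_iff e).1 he
  exacts [⟨_, hL.source_mem δ, rfl⟩, ⟨_, hL.target_mem δ, rfl⟩]

theorem edgesAperiodic (hL : Listing A S ι l) (hA : A.Aperiodic) : EdgesAperiodic l := by
  obtain ⟨m, hm, h⟩ := hA
  refine ⟨m, fun x y u hu => ?_⟩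
  have hne {j : ℕ} (hj : 1 ≤ j) : (List.replicate j u).flatten ≠ [] := by
    simp [List.flatten_eq_nil_iff, hu, Nat.one_le_iff_ne_zero.1 hj]
  by_cases hxy : x ∈ states l ∧ y ∈ states l
  · obtain ⟨p, hp, rfl⟩ := hL.exists_of_mem_states hxy.1
    obtain ⟨q, hq, rfl⟩ := hL.exists_of_mem_states hxy.2
    rw [hL.exists_run_iff hp hq, hL.exists_run_iff hp hq]
    exact h p q u hu
  · have hno {j : ℕ} (hj : 1 ≤ j) : ¬ ∃ ρ, Run l x y (List.replicate j u).flatten ρ :=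
      fun ⟨_, hρ⟩ => hxy ⟨hρ.source_mem (hne hj), hρ.target_mem (hne hj)⟩
    exact iff_of_false (hno hm) (hno m.succ_pos)

theorem edgesUnambiguous (hL : Listing A S ι l) (hA : A.SCCUnambiguous) :
    EdgesUnambiguous l := by
  rintro x y ⟨v, ρ₁, hρ₁⟩ ⟨w, ρ₂, hρ₂⟩ u ρ ρ' hρ hρ'
  by_cases hu : u = []
  · subst hu
    rw [List.eq_nil_of_length_eq_zero hρ.length_eq, List.eq_nil_of_length_eq_zero hρ'.length_eq]
  · obtain ⟨p, hp, rfl⟩ := hL.exists_of_mem_states (hρ.source_mem hu)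
    obtain ⟨q, hq, rfl⟩ := hL.exists_of_mem_states (hρ.target_mem hu)
    obtain ⟨τ₁, hτ₁, -⟩ := (hL.run_iff hp hq).1 hρ₁
    obtain ⟨τ₂, hτ₂, -⟩ := (hL.run_iff hq hp).1 hρ₂
    obtain ⟨τ, hτ, rfl⟩ := (hL.run_iff hp hq).1 hρ
    obtain ⟨τ', hτ', rfl⟩ := (hL.run_iff hp hq).1 hρ'
    rw [hA p q (.inr ⟨⟨τ₁, hτ₁.1⟩, τ₂, hτ₂.1⟩) u hu hτ hτ']

end Listing

open Classical in
/-- A sentence for a pair of states of an automaton listed by `l`, possibly with repetitions. -/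
noncomputable def pairSentence (l : List (Edge α R)) (p q : ℕ) : WFO α R := pairFormula l.dedup p q

/-- A sentence for lists of initial and final states. -/
noncomputable def accSentence (l : List (Edge α R)) (lI lF : List ℕ) : WFO α R :=
  WFO.sumList ((lI.dedup.product lF.dedup).map fun x => pairSentence l x.1 x.2)

theorem isSentence_pairSentence (l : List (Edge α R)) (p q : ℕ) :
    (pairSentence l p q).IsSentence := isSentence_pairFormula _ _ _

theorem isSentence_accSentence (l : List (Edge α R)) (lI lF : List ℕ) :
    (accSentence l lI lF).IsSentence :=
  WFO.fv_sumList <| List.forall_mem_map.2 fun x _ => isSentence_pairSentence l x.1 x.2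

theorem Listing.usem_eq (hL : Listing A S ι l) (hA : A.Aperiodic) (hU : A.SCCUnambiguous)
    (hp : p ∈ S) (hq : q ∈ S) : A.usem p q = (pairSentence l (ι p) (ι q)).usem := by
  classical
  funext u
  have hmap := List.map_injective_iff.2 hL.edgeOf_injective
  rw [WFO.usem, pairSentence, sem_pairFormula (hL.dedup.edgesAperiodic hA)
    (hL.dedup.edgesUnambiguous hU) (List.nodup_dedup l) _
    (S := (A.runs_finite p q u.1).toFinset.map ⟨_, hmap⟩)
    (fun ρ => by simp [hL.dedup.run_iff hp hq]), Finset.map_val, Multiset.map_map]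
  exact Multiset.map_congr rfl fun ρ _ => by simp [WAut.wgtSeq, edgeOf]

theorem Listing.usemAcc_eq (hL : Listing A S ι l) (hA : A.Aperiodic) (hU : A.SCCUnambiguous)
    {I F : Finset Q} (hI : ∀ p ∈ I, p ∈ S) (hF : ∀ q ∈ F, q ∈ S) {lI lF : List ℕ}
    (hlI : lI.toFinset = I.image ι) (hlF : lF.toFinset = F.image ι) :
    A.usemAcc I F = (accSentence l lI lF).usem := by
  funext u
  have hprod : (lI.dedup.product lF.dedup).toFinset = I.image ι ×ˢ F.image ι := by
    ext ⟨x, y⟩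
    rw [Finset.mem_product, ← hlI, ← hlF]
    simp only [List.mem_toFinset, List.pair_mem_product, List.mem_dedup]
  have hnodup : (lI.dedup.product lF.dedup).Nodup :=
    (List.nodup_dedup lI).product (List.nodup_dedup lF)
  rw [WFO.usem, accSentence, WFO.sem_sumList, List.map_map, ← List.sum_toFinset _ hnodup, hprod,
    Finset.sum_product, Finset.sum_image (hL.injOn.mono hI)]
  refine Finset.sum_congr rfl fun p hp => ?_
  rw [Finset.sum_image (hL.injOn.mono hF)]
  refine Finset.sum_congr rfl fun q hq => ?_
  rw [hL.usem_eq hA hU (hI p hp) (hF q hq)]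
  rfl

theorem exists_sentence_usem (hA : A.Aperiodic) (hU : A.SCCUnambiguous) (p q : Q) :
    ∃ Φ : WFO α R, Φ.IsSentence ∧ A.usem p q = Φ.usem := by
  classical
  obtain ⟨S, ι, l, hL, hS⟩ := exists_listing_superset A {p, q}
  exact ⟨_, isSentence_pairSentence _ _ _, hL.usem_eq hA hU (hS p (by simp)) (hS q (by simp))⟩

theorem exists_sentence_usemAcc (hA : A.Aperiodic) (hU : A.SCCUnambiguous) (I F : Finset Q) :
    ∃ Φ : WFO α R, Φ.IsSentence ∧ A.usemAcc I F = Φ.usem := by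
  classical
  obtain ⟨S, ι, l, hL, hS⟩ := exists_listing_superset A (I ∪ F)
  exact ⟨_, isSentence_accSentence _ _ _, hL.usemAcc_eq hA hU
    (fun p hp => hS p (Finset.mem_union_left _ hp)) (fun q hq => hS q (Finset.mem_union_right _ hq))
    (Finset.toList_toFinset _) (Finset.toList_toFinset _)⟩

theorem WAut.ListedBy.usem_eq {n : ℕ} {A : WAut α R (Fin n)} (hl : A.ListedBy l)
    (hA : A.Aperiodic) (hU : A.SCCUnambiguous) (p q : Fin n) :
    A.usem p q = (pairSentence l p q).usem :=
  hl.listing.usem_eq hA hU (Set.mem_univ p) (Set.mem_univ q)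

theorem WAut.ListedBy.usemAcc_eq {n : ℕ} {A : WAut α R (Fin n)} (hl : A.ListedBy l)
    (hA : A.Aperiodic) (hU : A.SCCUnambiguous) (lI lF : List (Fin n)) :
    A.usemAcc lI.toFinset lF.toFinset = (accSentence l (lI.map Fin.val) (lF.map Fin.val)).usem :=
  hl.listing.usemAcc_eq hA hU (fun p _ => Set.mem_univ p) (fun q _ => Set.mem_univ q)
    (by ext; simp) (by ext; simp)

end Listing

/-! ### Primitive recursiveness of the search for canonical positions -/

theorem dedup_eq_foldr {β : Type*} [DecidableEq β] (L : List β) :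
    L.dedup = L.foldr (fun x M => if x ∈ M then M else x :: M) [] := by
  induction L with
  | nil => rfl
  | cons x L ih =>
    rw [List.foldr_cons, ← ih]
    split_ifs with hx
    · rw [List.dedup_cons_of_mem (List.mem_dedup.1 hx)]
    · rw [List.dedup_cons_of_notMem (mt List.mem_dedup.2 hx)]

section Primrec

variable {γ β : Type*} [Primcodable γ] [Primcodable β]

theorem primrecPred_forall_mem {L : γ → List β} {r : γ → β → Prop} (hL : Primrec L)
    (hr : PrimrecRel r) : PrimrecPred fun c => ∀ x ∈ L c, r c x :=
  PrimrecRel.comp (PrimrecRel.forall_mem_list hr.swap) hL Primrec.id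

theorem primrecPred_exists_mem {L : γ → List β} {r : γ → β → Prop} (hL : Primrec L)
    (hr : PrimrecRel r) : PrimrecPred fun c => ∃ x ∈ L c, r c x :=
  PrimrecRel.comp (PrimrecRel.exists_mem_list hr.swap) hL Primrec.id

theorem primrecPred_exists_mem_option {o : γ → Option β} {r : γ → β → Prop} (ho : Primrec o)
    (hr : PrimrecRel r) : PrimrecPred fun c => ∃ x ∈ o c, r c x :=
  (primrecPred_exists_mem (Primrec.optionToList.comp ho) hr).of_eq fun c => by
    simp only [Option.mem_toList, Option.mem_def]

theorem primrecPred_forall_lt {n : γ → ℕ} {r : γ → ℕ → Prop} (hn : Primrec n)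
    (hr : PrimrecRel r) : PrimrecPred fun c => ∀ x < n c, r c x :=
  (primrecPred_forall_mem (Primrec.list_range.comp hn) hr).of_eq fun c => by
    simp only [List.mem_range]

theorem primrec_filter {L : γ → List β} {r : γ → β → Prop} [∀ c, DecidablePred (r c)]
    (hL : Primrec L) (hr : PrimrecRel r) : Primrec fun c => (L c).filter fun x => r c x := by
  classical
  exact ((PrimrecRel.listFilter (R := fun a b => r b a) hr.swap).comp hL Primrec.id).of_eq
    fun c => List.filter_congr fun x _ => decide_eq_decide.2 Iff.rfl

theorem primrec_pow : Primrec₂ ((· ^ ·) : ℕ → ℕ → ℕ) := Primrec₂.unpaired'.1 Nat.Primrec.pow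

theorem primrec_dedup [DecidableEq β] : Primrec (List.dedup : List β → List β) := by
  have hmem : PrimrecPred fun z : List β × β × List β => z.2.1 ∈ z.2.2 :=
    (primrecPred_exists_mem (r := fun z x => x = z.2.1) (Primrec.snd.comp .snd)
      (Primrec.eq.comp .snd (Primrec.fst.comp (Primrec.snd.comp .fst)))).of_eq
      fun z => exists_eq_right
  exact (Primrec.list_foldr (h := fun _ z => if z.1 ∈ z.2 then z.2 else z.1 :: z.2) .id
    (.const []) (Primrec.ite hmem (Primrec.snd.comp .snd) (Primrec.list_cons.comp
      (Primrec.fst.comp .snd) (Primrec.snd.comp .snd)))).of_eq fun L => (dedup_eq_foldr L).symm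

theorem primrec_tuples : Primrec₂ (tuples : List β → ℕ → List (List β)) := by
  have hstep : Primrec₂ fun (L : List β) (z : ℕ × List (List β)) =>
      z.2.flatMap fun t => L.map fun x => t ++ [x] :=
    Primrec.list_flatMap (Primrec.snd.comp .snd) (Primrec.list_map (Primrec.fst.comp .fst)
      (Primrec.list_concat.comp (Primrec.snd.comp .fst) .snd))
  refine (Primrec.nat_rec (Primrec.const [[]]) hstep).of_eq fun L m => ?_
  induction m with
  | zero => rfl
  | succ m ih => simp only [tuples] at ih ⊢; rw [ih]

theorem primrec_seqs : Primrec₂ (seqs : List β → ℕ → List (List β)) :=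
  Primrec.list_flatMap (Primrec.list_range.comp .snd)
    (primrec_tuples.comp (Primrec.fst.comp .fst) .snd)

end Primrec

theorem primrec_counterFreeRank : Primrec counterFreeRank := by
  have hstep : Primrec₂ fun n K : ℕ => (n + 1) ^ (n + 1) * (K + 1) :=
    Primrec.nat_mul.comp (primrec_pow.comp (Primrec.succ.comp .fst) (Primrec.succ.comp .fst))
      (Primrec.succ.comp .snd)
  refine (Primrec.nat_rec₁ 0 hstep).of_eq fun n => ?_
  induction n with
  | zero => rfl
  | succ n ih => simp only [counterFreeRank, ih]

theorem primrec_wordTypeCount : Primrec fun z : ℕ × ℕ × ℕ => wordTypeCount z.1 z.2.1 z.2.2 := by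
  have hD : Primrec fun z : ℕ × ℕ × ℕ => z.2.1 := Primrec.fst.comp .snd
  have hatomic : Primrec fun z : ℕ × ℕ × ℕ => (2 ^ z.2.1) ^ z.2.1 * (z.1 + 1) ^ z.2.1 :=
    Primrec.nat_mul.comp (primrec_pow.comp (primrec_pow.comp (.const 2) hD) hD)
      (primrec_pow.comp (Primrec.succ.comp .fst) hD)
  have hstep : Primrec₂ fun (z : ℕ × ℕ × ℕ) (y : ℕ × ℕ) =>
      (2 ^ z.2.1) ^ z.2.1 * (z.1 + 1) ^ z.2.1 * 2 ^ y.2 :=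
    Primrec.nat_mul.comp (hatomic.comp .fst)
      (primrec_pow.comp (.const 2) (Primrec.snd.comp .snd))
  refine (Primrec.nat_rec' (Primrec.snd.comp .snd) hatomic hstep).of_eq fun ⟨b, D, k⟩ => ?_
  induction k with
  | zero => rfl
  | succ k ih => simp only [wordTypeCount] at ih ⊢; rw [ih]

section Search

variable {α R : Type*} [Primcodable α] [Primcodable R]

theorem primrec_src : Primrec fun δ : Edge α R => δ.1 := Primrec.fst

theorem primrec_label : Primrec fun δ : Edge α R => δ.2.1 := Primrec.fst.comp .snd

theorem primrec_tgt : Primrec fun δ : Edge α R => δ.2.2.1 :=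
  Primrec.fst.comp (Primrec.snd.comp .snd)

theorem primrec_weight : Primrec fun δ : Edge α R => δ.2.2.2 :=
  Primrec.snd.comp (Primrec.snd.comp .snd)

theorem primrec_runRank : Primrec (runRank : List (Edge α R) → ℕ) :=
  Primrec.succ.comp (primrec_counterFreeRank.comp (primrec_pow.comp (.const 2)
    (Primrec.nat_mul.comp (.const 2) .list_length)))

theorem primrec_shortBound : Primrec (shortBound : List (Edge α R) → ℕ) := by
  have h : Primrec fun l : List (Edge α R) => runRank l + (l.length + 1) :=
    Primrec.nat_add.comp primrec_runRank (Primrec.succ.comp .list_length)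
  exact primrec_wordTypeCount.comp (Primrec.list_length.pair (h.pair h))

theorem primrec_pathEnd : Primrec₂ (pathEnd : ℕ → List (Edge α R) → Option ℕ) := by
  have hstep : Primrec₂ fun (_ : ℕ × List (Edge α R)) (z : Option ℕ × Edge α R) =>
      stepState z.1 z.2 :=
    Primrec.ite (Primrec.eq.comp (Primrec.fst.comp .snd)
        (Primrec.option_some.comp (primrec_src.comp (Primrec.snd.comp .snd))))
      (Primrec.option_some.comp (primrec_tgt.comp (Primrec.snd.comp .snd))) (.const none)
  exact Primrec.list_foldl .snd (Primrec.option_some.comp .fst) hstep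

variable {γ : Type*} [Primcodable γ] {l e ρ : γ → List (Edge α R)}

theorem primrecPred_reach {x y : γ → ℕ} (hl : Primrec l) (hx : Primrec x) (hy : Primrec y) :
    PrimrecPred fun z => Reach (l z) (x z) (y z) :=
  primrecPred_exists_mem (primrec_seqs.comp hl (primrec_shortBound.comp hl))
    (Primrec.eq.comp (primrec_pathEnd.comp (hx.comp .fst) .snd)
      (Primrec.option_some.comp (hy.comp .fst)))

theorem primrec_height {x : γ → ℕ} (hl : Primrec l) (hx : Primrec x) :
    Primrec fun z => height (l z) (x z) := by
  classical
  have hr : PrimrecRel fun (z : γ) (δ : Edge α R) => ¬ Reach (l z) (x z) δ.1 :=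
    (primrecPred_reach (hl.comp .fst) (hx.comp .fst) (primrec_src.comp .snd)).not
  exact (Primrec.list_length.comp (primrec_filter hl hr)).of_eq
    fun z => by unfold height; congr!

theorem primrecPred_isCanonical {i x : γ → ℕ} (hl : Primrec l) (hρ : Primrec ρ)
    (hi : Primrec i) (hx : Primrec x) :
    PrimrecPred fun z => IsCanonical (height (l z)) (ρ z) (i z) (x z) := by
  have hl' : Primrec fun y : γ × Edge α R => l y.1 := hl.comp .fst
  have hbelow : PrimrecRel fun (z : γ) (δ : Edge α R) => i z < height (l z) δ.2.2.1 :=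
    Primrec.nat_lt.comp (hi.comp .fst) (primrec_height hl' (primrec_tgt.comp .snd))
  have habove : PrimrecRel fun (z : γ) (δ : Edge α R) => height (l z) δ.1 ≤ i z :=
    Primrec.nat_le.comp (primrec_height hl' (primrec_src.comp .snd)) (hi.comp .fst)
  have hlast : PrimrecPred fun z => x z + 1 = (ρ z).length :=
    Primrec.eq.comp (Primrec.succ.comp hx) (Primrec.list_length.comp hρ)
  have hfirst : PrimrecPred fun z => x z = 0 := Primrec.eq.comp hx (.const 0)
  exact primrecPred_exists_mem_option (Primrec.list_getElem?.comp hρ hx)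
    ((hbelow.or (hlast.comp .fst)).and ((hfirst.comp .fst).or habove))

theorem primrecPred_matches {J : γ → ℕ} {t : γ → List ℕ} (hl : Primrec l) (hJ : Primrec J)
    (hρ : Primrec ρ) (ht : Primrec t) (he : Primrec e) :
    PrimrecPred fun z => Matches (height (l z)) (J z) (ρ z) (t z) (e z) := by
  have htD : Primrec₂ fun (z : γ) (i : ℕ) => (t z).getD i 0 :=
    (Primrec.list_getD 0).comp (ht.comp .fst) .snd
  have hedge : PrimrecPred fun z => ∀ i < (e z).length, (ρ z)[(t z).getD i 0]? = (e z)[i]? :=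
    primrecPred_forall_lt (Primrec.list_length.comp he)
      (Primrec.eq.comp (Primrec.list_getElem?.comp (hρ.comp .fst) htD)
        (Primrec.list_getElem?.comp (he.comp .fst) .snd))
  exact hedge.and (primrecPred_forall_lt hJ
    (primrecPred_isCanonical (hl.comp .fst) (hρ.comp .fst) .snd htD))

theorem primrecPred_witness {p q : γ → ℕ} {x : γ → List (Edge α R) × List ℕ}
    (hl : Primrec l) (hp : Primrec p) (hq : Primrec q) (he : Primrec e) (hx : Primrec x) :
    PrimrecPred fun z => Witness (l z) (p z) (q z) (e z) (x z) := by
  have hρ : Primrec fun z => (x z).1 := Primrec.fst.comp hx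
  have hend : PrimrecPred fun z => pathEnd (p z) (x z).1 = some (q z) :=
    Primrec.eq.comp (primrec_pathEnd.comp hp hρ) (Primrec.option_some.comp hq)
  exact (Primrec.eq.comp hρ (.const [])).not.and (hend.and
    (primrecPred_matches hl (Primrec.list_length.comp hl) hρ (Primrec.snd.comp hx) he))

theorem primrec_pointedSeqs :
    Primrec₂ (pointedSeqs : List (Edge α R) → ℕ → List (List (Edge α R) × List ℕ)) := by
  have hseqs : Primrec fun z : List (Edge α R) × ℕ => seqs z.1 (shortBound z.1) :=
    primrec_seqs.comp .fst (primrec_shortBound.comp .fst)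
  exact Primrec.list_flatMap hseqs (Primrec.list_map (primrec_tuples.comp
    (Primrec.list_range.comp (Primrec.list_length.comp .snd)) (Primrec.snd.comp .fst))
    (Primrec.pair (Primrec.snd.comp .fst) .snd))

end Search

/-! ### Gödel numbers of the formulas -/

section FOCodes

/-- Gödel number of a conjunction, from the Gödel numbers of its members. -/
def conjCode (L : List ℕ) : ℕ :=
  L.foldr (fun c d => Nat.pair 4 (Nat.pair c d)) (Nat.pair 0 0)

/-- Gödel number of a disjunction, from the Gödel numbers of its members. -/
def disjCode (L : List ℕ) : ℕ := Nat.pair 3 (conjCode (L.map (Nat.pair 3)))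

/-- Gödel number of an existential quantification over the variable `x`, from the Gödel number `c`
of the quantified formula. -/
def exCode (x c : ℕ) : ℕ := Nat.pair 3 (Nat.pair 5 (Nat.pair x (Nat.pair 3 c)))

theorem code_conj {α : Type*} [Encodable α] (L : List (FO α)) :
    (FO.conj L).code = conjCode (L.map FO.code) := by
  induction L with
  | nil => rfl
  | cons φ L ih => simp only [FO.conj, FO.code, ih, conjCode, List.map_cons, List.foldr_cons]

theorem code_disj {α : Type*} [Encodable α] (L : List (FO α)) :
    (FO.disj L).code = disjCode (L.map FO.code) := by
  rw [FO.disj, FO.code, code_conj, disjCode, List.map_map, List.map_map]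
  rfl

theorem primrec_natPair_left (k : ℕ) : Primrec (Nat.pair k) :=
  Primrec₂.natPair.comp (.const k) .id

theorem primrec_foldr_natPair (k : ℕ) : Primrec fun L : List ℕ =>
    L.foldr (fun c d => Nat.pair k (Nat.pair c d)) (Nat.pair 0 0) :=
  Primrec.list_foldr (h := fun _ z => Nat.pair k (Nat.pair z.1 z.2)) .id (.const _)
    ((primrec_natPair_left k).comp
      (Primrec₂.natPair.comp (Primrec.fst.comp .snd) (Primrec.snd.comp .snd)))

theorem primrec_conjCode : Primrec conjCode := primrec_foldr_natPair 4

theorem primrec_disjCode : Primrec disjCode :=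
  (primrec_natPair_left 3).comp (primrec_conjCode.comp
    (Primrec.list_map .id ((primrec_natPair_left 3).comp .snd)))

theorem primrec_exCode : Primrec₂ exCode :=
  (primrec_natPair_left 3).comp ((primrec_natPair_left 5).comp
    (Primrec₂.natPair.comp .fst ((primrec_natPair_left 3).comp .snd)))

variable {α : Type*} [Primcodable α] {γ β : Type*} [Primcodable γ] [Primcodable β]

theorem primrec_code_conj_map {L : γ → List β} {φ : γ → β → FO α} (hL : Primrec L)
    (hφ : Primrec₂ fun z x => (φ z x).code) :
    Primrec fun z => (FO.conj ((L z).map (φ z))).code :=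
  (primrec_conjCode.comp (Primrec.list_map hL hφ)).of_eq fun z => by
    rw [code_conj, List.map_map]; rfl

theorem primrec_code_disj_map {L : γ → List β} {φ : γ → β → FO α} (hL : Primrec L)
    (hφ : Primrec₂ fun z x => (φ z x).code) :
    Primrec fun z => (FO.disj ((L z).map (φ z))).code :=
  (primrec_disjCode.comp (Primrec.list_map hL hφ)).of_eq fun z => by
    rw [code_disj, List.map_map]; rfl

theorem primrec_code_letterEq {w : γ → List α} {x i : γ → ℕ} (hw : Primrec w) (hx : Primrec x)
    (hi : Primrec i) : Primrec fun z => (FO.letterEq (w z) (x z) (i z)).code := by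
  have h : Primrec₂ fun (z : γ) (a : α) => (FO.letter a (i z)).code :=
    (primrec_natPair_left 1).comp
      (Primrec₂.natPair.comp (Primrec.encode.comp .snd) (hi.comp .fst))
  refine (Primrec.option_casesOn (Primrec.list_getElem?.comp hw hx)
    (.const (FO.code (FO.top : FO α))) h).of_eq fun z => ?_
  rw [FO.letterEq]
  cases (w z)[x z]? <;> rfl

theorem primrec_code_orderEq {x y i j : γ → ℕ} (hx : Primrec x) (hy : Primrec y)
    (hi : Primrec i) (hj : Primrec j) :
    Primrec fun z => (FO.orderEq (x z) (y z) (i z) (j z) : FO α).code := by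
  have h : Primrec fun z => (FO.le (i z) (j z) : FO α).code :=
    (primrec_natPair_left 2).comp (Primrec₂.natPair.comp hi hj)
  refine (Primrec.ite (Primrec.nat_le.comp hx hy) h ((primrec_natPair_left 3).comp h)).of_eq
    fun z => ?_
  rw [FO.orderEq]
  split_ifs <;> rfl

theorem primrec_code_diagram {w : γ → List α} {t : γ → List ℕ} (hw : Primrec w)
    (ht : Primrec t) : Primrec fun z => (FO.diagram (w z) (t z)).code := by
  have hr : Primrec fun z => List.range (t z).length :=
    Primrec.list_range.comp (Primrec.list_length.comp ht)
  have hD : Primrec₂ fun z i => (t z).getD i 0 :=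
    (Primrec.list_getD 0).comp (ht.comp .fst) .snd
  have hletters : Primrec fun z => (FO.conj ((List.range (t z).length).map fun i =>
      FO.letterEq (w z) ((t z).getD i 0) i)).code :=
    primrec_code_conj_map hr (primrec_code_letterEq (hw.comp .fst) hD .snd)
  have hz : Primrec fun y : (γ × ℕ) × ℕ => y.1.1 := Primrec.fst.comp .fst
  have hi : Primrec fun y : (γ × ℕ) × ℕ => y.1.2 := Primrec.snd.comp .fst
  have horders : Primrec fun z => (FO.conj ((List.range (t z).length).map fun i =>
      (FO.conj ((List.range (t z).length).map fun j =>
        FO.orderEq ((t z).getD i 0) ((t z).getD j 0) i j) : FO α))).code :=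
    primrec_code_conj_map hr (primrec_code_conj_map (hr.comp .fst)
      (primrec_code_orderEq (hD.comp hz hi) (hD.comp hz .snd) hi .snd))
  exact (primrec_natPair_left 4).comp (Primrec₂.natPair.comp hletters horders)

end FOCodes

section HintikkaCodes

/-- Gödel number of a Hintikka formula of positive rank for `d` positions, from the Gödel number `c`
of their diagram and the Gödel numbers `L` of the Hintikka formulas with one more position. -/
def hintikkaStep (c d : ℕ) (L : List ℕ) : ℕ :=
  Nat.pair 4 (Nat.pair c (Nat.pair 4 (Nat.pair (conjCode (L.map (exCode d)))
    (Nat.pair 5 (Nat.pair d (disjCode L))))))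

/-- The arguments at which the recursive definition of `FO.hintikka` calls itself. -/
def hintikkaChildren {α : Type*} : List α × ℕ × List ℕ → List (List α × ℕ × List ℕ)
  | (_, 0, _) => []
  | (w, k + 1, t) => (List.range w.length).map fun x => (w, k, t ++ [x])

theorem code_hintikka_succ {α : Type*} [Encodable α] (w : List α) (k : ℕ) (t : List ℕ) :
    (FO.hintikka w (k + 1) t).code = hintikkaStep (FO.diagram w t).code t.length
      ((hintikkaChildren (w, k + 1, t)).map fun z => (FO.hintikka z.1 z.2.1 z.2.2).code) := by
  simp only [FO.hintikka, FO.code, code_conj, code_disj, hintikkaStep, hintikkaChildren,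
    List.map_map]
  rfl

theorem primrec_hintikkaStep {γ : Type*} [Primcodable γ] {c d : γ → ℕ} {L : γ → List ℕ}
    (hc : Primrec c) (hd : Primrec d) (hL : Primrec L) :
    Primrec fun z => hintikkaStep (c z) (d z) (L z) := by
  have hexists : Primrec fun z => conjCode ((L z).map (exCode (d z))) :=
    primrec_conjCode.comp (Primrec.list_map hL (primrec_exCode.comp (hd.comp .fst) .snd))
  have hforall : Primrec fun z => Nat.pair 5 (Nat.pair (d z) (disjCode (L z))) :=
    (primrec_natPair_left 5).comp (Primrec₂.natPair.comp hd (primrec_disjCode.comp hL))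
  exact (primrec_natPair_left 4).comp (Primrec₂.natPair.comp hc
    ((primrec_natPair_left 4).comp (Primrec₂.natPair.comp hexists hforall)))

variable {α : Type*} [Primcodable α]

theorem primrec_hintikkaChildren :
    Primrec (hintikkaChildren : List α × ℕ × List ℕ → List (List α × ℕ × List ℕ)) := by
  have hw : Primrec fun z : List α × ℕ × List ℕ => z.1 := Primrec.fst
  have ht : Primrec fun z : List α × ℕ × List ℕ => z.2.2 := Primrec.snd.comp .snd
  have hchildren : Primrec₂ fun (z : List α × ℕ × List ℕ) (k : ℕ) =>
      (List.range z.1.length).map fun x => (z.1, k, z.2.2 ++ [x]) :=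
    Primrec.list_map (Primrec.list_range.comp (Primrec.list_length.comp (hw.comp .fst)))
      ((hw.comp (Primrec.fst.comp .fst)).pair (Primrec.pair (Primrec.snd.comp .fst)
        (Primrec.list_concat.comp (ht.comp (Primrec.fst.comp .fst)) .snd)))
  refine (Primrec.nat_casesOn (Primrec.fst.comp .snd) (.const []) hchildren).of_eq ?_
  rintro ⟨w, _ | k, t⟩ <;> rfl

theorem primrec_code_hintikka_uncurried :
    Primrec fun z : List α × ℕ × List ℕ => (FO.hintikka z.1 z.2.1 z.2.2).code := by
  have hk : Primrec fun z : List α × ℕ × List ℕ => z.2.1 := Primrec.fst.comp .snd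
  have ht : Primrec fun z : List α × ℕ × List ℕ => z.2.2 := Primrec.snd.comp .snd
  have hdiagram : Primrec fun z : List α × ℕ × List ℕ => (FO.diagram z.1 z.2.2).code :=
    primrec_code_diagram .fst ht
  have hstep : Primrec₂ fun (z : List α × ℕ × List ℕ) (L : List ℕ) =>
      if z.2.1 = 0 then (FO.diagram z.1 z.2.2).code
      else hintikkaStep (FO.diagram z.1 z.2.2).code z.2.2.length L :=
    Primrec.ite ((Primrec.eq.comp hk (.const 0)).comp .fst) (hdiagram.comp .fst)
      (primrec_hintikkaStep (hdiagram.comp .fst) (Primrec.list_length.comp (ht.comp .fst)) .snd)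
  refine Primrec.nat_omega_rec' (fun z : List α × ℕ × List ℕ => (FO.hintikka z.1 z.2.1 z.2.2).code)
    hk primrec_hintikkaChildren (Primrec.option_some.comp₂ hstep) ?_ ?_
  · rintro ⟨w, _ | k, t⟩ z hz
    · exact absurd hz List.not_mem_nil
    · obtain ⟨x, -, rfl⟩ := List.mem_map.1 hz
      exact Nat.lt_succ_self k
  · rintro ⟨w, _ | k, t⟩
    · rfl
    · rw [code_hintikka_succ, if_neg (Nat.succ_ne_zero k)]

theorem primrec_code_hintikka {γ : Type*} [Primcodable γ] {w : γ → List α} {k : γ → ℕ}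
    {t : γ → List ℕ} (hw : Primrec w) (hk : Primrec k) (ht : Primrec t) :
    Primrec fun z => (FO.hintikka (w z) (k z) (t z)).code :=
  primrec_code_hintikka_uncurried.comp (hw.pair (hk.pair ht))

end HintikkaCodes

section WFOCodes

theorem code_sumList {α R : Type*} [Encodable α] [Encodable R] (L : List (WFO α R)) :
    (WFO.sumList L).code =
      (L.map WFO.code).foldr (fun c d => Nat.pair 3 (Nat.pair c d)) (Nat.pair 0 0) := by
  induction L with
  | nil => rfl
  | cons Φ L ih => simp only [WFO.sumList, WFO.code, ih, List.map_cons, List.foldr_cons]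

theorem code_sumVars {α R : Type*} [Encodable α] [Encodable R] (j : ℕ) (Φ : WFO α R) :
    (WFO.sumVars j Φ).code =
      (List.range j).foldr (fun i c => Nat.pair 4 (Nat.pair i c)) Φ.code := by
  induction j generalizing Φ with
  | zero => rfl
  | succ j ih => rw [WFO.sumVars, ih, List.range_succ, List.foldr_append]; rfl

theorem code_weightFormula {α R : Type*} [Encodable α] [Encodable R] (l e : List (Edge α R))
    (p q : ℕ) (r : R) :
    (weightFormula l p q e r).code = l.foldr (fun δ c => Nat.pair 1 (Nat.pair
      (runFormula l p q (e ++ [δ])).code (Nat.pair (Nat.pair 0 (Encodable.encode δ.2.2.2)) c)))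
      (Nat.pair 0 (Encodable.encode r)) :=
  (List.foldr_hom StepFO.code fun _ _ => rfl).symm

variable {α R : Type*} [Primcodable α] [Primcodable R] {γ β : Type*} [Primcodable γ]
  [Primcodable β] {l e : γ → List (Edge α R)} {p q : γ → ℕ} {r : γ → R}

theorem primrec_code_sumList_map {L : γ → List β} {Φ : γ → β → WFO α R} (hL : Primrec L)
    (hΦ : Primrec₂ fun z x => (Φ z x).code) :
    Primrec fun z => (WFO.sumList ((L z).map (Φ z))).code :=
  ((primrec_foldr_natPair 3).comp (Primrec.list_map hL hΦ)).of_eq fun z => by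
    rw [code_sumList, List.map_map]; rfl

theorem primrec_code_sumVars {j : γ → ℕ} {Φ : γ → WFO α R} (hj : Primrec j)
    (hΦ : Primrec fun z => (Φ z).code) : Primrec fun z => (WFO.sumVars (j z) (Φ z)).code :=
  (Primrec.list_foldr (Primrec.list_range.comp hj) hΦ
    (h := fun _ y => Nat.pair 4 (Nat.pair y.1 y.2)) ((primrec_natPair_left 4).comp
      (Primrec₂.natPair.comp (Primrec.fst.comp .snd) (Primrec.snd.comp .snd)))).of_eq
    fun _ => (code_sumVars _ _).symm

theorem primrec_code_runFormula (hl : Primrec l) (hp : Primrec p) (hq : Primrec q)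
    (he : Primrec e) : Primrec fun z => (runFormula (l z) (p z) (q z) (e z)).code := by
  classical
  have hwitnesses : Primrec fun z => (pointedSeqs (l z) (e z).length).filter fun x =>
      Witness (l z) (p z) (q z) (e z) x :=
    primrec_filter (primrec_pointedSeqs.comp hl (Primrec.list_length.comp he))
      (primrecPred_witness (hl.comp .fst) (hp.comp .fst) (hq.comp .fst) (he.comp .fst) .snd)
  have hword : Primrec fun y : γ × List (Edge α R) × List ℕ => y.2.1.map fun δ => δ.2.1 :=
    Primrec.list_map (Primrec.fst.comp .snd) (primrec_label.comp .snd)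
  have hrank : Primrec fun y : γ × List (Edge α R) × List ℕ => runRank (l y.1) :=
    primrec_runRank.comp (hl.comp .fst)
  have hhintikka : Primrec₂ fun (z : γ) (x : List (Edge α R) × List ℕ) =>
      (FO.hintikka (x.1.map fun δ => δ.2.1) (runRank (l z)) x.2).code :=
    primrec_code_hintikka hword hrank (Primrec.snd.comp .snd)
  refine (primrec_code_disj_map hwitnesses hhintikka).of_eq fun z => ?_
  unfold runFormula
  congr!

theorem primrec_code_weightFormula (hl : Primrec l) (hp : Primrec p) (hq : Primrec q)
    (he : Primrec e) (hr : Primrec r) :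
    Primrec fun z => (weightFormula (l z) (p z) (q z) (e z) (r z)).code := by
  have hδ : Primrec fun y : γ × Edge α R × ℕ => y.2.1 := Primrec.fst.comp .snd
  have hstep : Primrec₂ fun (z : γ) (y : Edge α R × ℕ) => Nat.pair 1 (Nat.pair
      (runFormula (l z) (p z) (q z) (e z ++ [y.1])).code
      (Nat.pair (Nat.pair 0 (Encodable.encode y.1.2.2.2)) y.2)) :=
    (primrec_natPair_left 1).comp (Primrec₂.natPair.comp
      (primrec_code_runFormula (hl.comp .fst) (hp.comp .fst) (hq.comp .fst)
        (Primrec.list_concat.comp (he.comp .fst) hδ))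
      (Primrec₂.natPair.comp ((primrec_natPair_left 0).comp
        (Primrec.encode.comp (primrec_weight.comp hδ))) (Primrec.snd.comp .snd)))
  exact (Primrec.list_foldr hl ((primrec_natPair_left 0).comp (Primrec.encode.comp hr))
    hstep).of_eq fun _ => (code_weightFormula _ _ _ _ _).symm

theorem primrec_code_matchFormula (hl : Primrec l) (hp : Primrec p) (hq : Primrec q)
    (he : Primrec e) (hr : Primrec r) :
    Primrec fun z => (matchFormula (l z) (p z) (q z) (e z) (r z)).code := by
  have hprod : Primrec fun z =>
      (WFO.prod (e z).length (weightFormula (l z) (p z) (q z) (e z) (r z))).code :=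
    (primrec_natPair_left 1).comp (Primrec₂.natPair.comp (Primrec.list_length.comp he)
      (primrec_code_weightFormula hl hp hq he hr))
  exact (primrec_natPair_left 2).comp (Primrec₂.natPair.comp
    (primrec_code_runFormula hl hp hq he) (Primrec₂.natPair.comp hprod (.const (Nat.pair 0 0))))

theorem primrec_code_pairFormula (hl : Primrec l) (hp : Primrec p) (hq : Primrec q) :
    Primrec fun z => (pairFormula (l z) (p z) (q z)).code := by
  have hz : Primrec fun y : (γ × Edge α R) × List (Edge α R) => y.1.1 := Primrec.fst.comp .fst
  have hlen : Primrec fun z => (l z).length := Primrec.list_length.comp hl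
  have hsome : Primrec₂ fun (z : γ) (δ : Edge α R) =>
      (WFO.sumList ((tuples (l z) (l z).length).map fun e =>
        WFO.sumVars (l z).length (matchFormula (l z) (p z) (q z) e δ.2.2.2))).code :=
    primrec_code_sumList_map (primrec_tuples.comp (hl.comp .fst) (hlen.comp .fst))
      (primrec_code_sumVars (hlen.comp hz) (primrec_code_matchFormula (hl.comp hz) (hp.comp hz)
        (hq.comp hz) .snd (primrec_weight.comp (Primrec.snd.comp .fst))))
  refine (Primrec.option_casesOn (Primrec.list_head?.comp hl)
    (.const (WFO.code (WFO.zero : WFO α R))) hsome).of_eq fun z => ?_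
  rw [pairFormula]
  cases (l z).head? <;> rfl

theorem primrec_code_pairSentence (hl : Primrec l) (hp : Primrec p) (hq : Primrec q) :
    Primrec fun z => (pairSentence (l z) (p z) (q z)).code := by
  classical
  exact primrec_code_pairFormula (primrec_dedup.comp hl) hp hq

theorem primrec_code_accSentence {lI lF : γ → List ℕ} (hl : Primrec l) (hI : Primrec lI)
    (hF : Primrec lF) : Primrec fun z => (accSentence (l z) (lI z) (lF z)).code := by
  have hpairs : Primrec fun z => (lI z).dedup.product (lF z).dedup :=
    Primrec.list_flatMap (primrec_dedup.comp hI) (Primrec.list_map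
      (primrec_dedup.comp (hF.comp .fst))
      (Primrec.pair (Primrec.snd.comp .fst) .snd))
  exact primrec_code_sumList_map hpairs (primrec_code_pairSentence (hl.comp .fst)
    (Primrec.fst.comp .snd) (Primrec.snd.comp .snd))

end WFOCodes

end WFOAut

open WFOAut in
theorem theorem5p5_general {α R : Type*} :
    (∀ (Q : Type*) (A : WAut α R Q), A.Aperiodic → A.SCCUnambiguous →
      (∀ p q : Q, ∃ Φ : WFO α R, Φ.IsSentence ∧ A.usem p q = Φ.usem) ∧
      (∀ I F : Finset Q, ∃ Φ : WFO α R, Φ.IsSentence ∧ A.usemAcc I F = Φ.usem)) ∧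
    (∀ [Primcodable α] [Primcodable R],
      (∃ f : List (ℕ × α × ℕ × R) × ℕ × ℕ → ℕ, Primrec f ∧
        ∀ (n : ℕ) (A : WAut α R (Fin n)), A.Aperiodic → A.SCCUnambiguous →
          ∀ l : List (ℕ × α × ℕ × R), A.ListedBy l → ∀ p q : Fin n,
            ∃ Φ : WFO α R, Φ.code = f (l, (p : ℕ), (q : ℕ)) ∧
              Φ.IsSentence ∧ A.usem p q = Φ.usem) ∧
      (∃ g : List (ℕ × α × ℕ × R) × List ℕ × List ℕ → ℕ, Primrec g ∧
        ∀ (n : ℕ) (A : WAut α R (Fin n)), A.Aperiodic → A.SCCUnambiguous →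
          ∀ l : List (ℕ × α × ℕ × R), A.ListedBy l → ∀ lI lF : List (Fin n),
            ∃ Φ : WFO α R, Φ.code = g (l, lI.map Fin.val, lF.map Fin.val) ∧
              Φ.IsSentence ∧ A.usemAcc lI.toFinset lF.toFinset = Φ.usem)) := by
  refine ⟨fun Q A hA hU => ⟨exists_sentence_usem hA hU, exists_sentence_usemAcc hA hU⟩,
    ⟨fun z => (pairSentence z.1 z.2.1 z.2.2).code, primrec_code_pairSentence .fst
      (.comp .fst .snd) (.comp .snd .snd), fun n A hA hU l hl p q =>
        ⟨_, rfl, isSentence_pairSentence _ _ _, hl.usem_eq hA hU p q⟩⟩,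
    ⟨fun z => (accSentence z.1 z.2.1 z.2.2).code, primrec_code_accSentence .fst
      (.comp .fst .snd) (.comp .snd .snd), fun n A hA hU l hl lI lF =>
        ⟨_, rfl, isSentence_accSentence _ _ _, hl.usemAcc_eq hA hU lI lF⟩⟩⟩

open WFOAut in
/-- Aperiodic SCC-unambiguous weighted automata have equivalent weighted first-order sentences, for
each pair of states and for the whole automaton (first part, arbitrary weights). The sentences can
be computed from the automaton, given as a finite list of weighted transitions, whenever the
weights can be coded (second part): the partial recursive functions `f` and `g` are defined at
least on all the listings of such automata, and return Gödel numbers of the required sentences. -/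
theorem theorem5p5 {α : Type*} [Fintype α] {R : Type*} :
    (∀ (Q : Type*) [Fintype Q] (A : WAut α R Q), A.Aperiodic → A.SCCUnambiguous →
      (∀ p q : Q, ∃ Φ : WFO α R, Φ.IsSentence ∧ A.usem p q = Φ.usem) ∧
      (∀ I F : Finset Q, ∃ Φ : WFO α R, Φ.IsSentence ∧ A.usemAcc I F = Φ.usem)) ∧
    (∀ [Primcodable α] [Primcodable R],
      (∃ f : List (ℕ × α × ℕ × R) × ℕ × ℕ →. ℕ, Partrec f ∧
        ∀ (n : ℕ) (A : WAut α R (Fin n)), A.Aperiodic → A.SCCUnambiguous →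
          ∀ l : List (ℕ × α × ℕ × R), A.ListedBy l → ∀ p q : Fin n,
            ∃ Φ : WFO α R, Φ.code ∈ f (l, (p : ℕ), (q : ℕ)) ∧
              Φ.IsSentence ∧ A.usem p q = Φ.usem) ∧
      (∃ g : List (ℕ × α × ℕ × R) × List ℕ × List ℕ →. ℕ, Partrec g ∧
        ∀ (n : ℕ) (A : WAut α R (Fin n)), A.Aperiodic → A.SCCUnambiguous →
          ∀ l : List (ℕ × α × ℕ × R), A.ListedBy l → ∀ lI lF : List (Fin n),
            ∃ Φ : WFO α R, Φ.code ∈ g (l, lI.map Fin.val, lF.map Fin.val) ∧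
              Φ.IsSentence ∧ A.usemAcc lI.toFinset lF.toFinset = Φ.usem)) := by
  obtain ⟨hex, hcode⟩ := theorem5p5_general (α := α) (R := R)
  refine ⟨fun Q _ => hex Q, ?_⟩
  intro _ _
  obtain ⟨⟨f, hf, hfspec⟩, g, hg, hgspec⟩ := hcode
  exact ⟨⟨f, hf.to_comp.partrec, by simpa using hfspec⟩,
    ⟨g, hg.to_comp.partrec, by simpa using hgspec⟩⟩
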